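/- Let $I$ be a finite set and let $A=(\langle i,j\rangle)_{i,j\in I}$ be a Cartan matrix of finite ADE type, or of affine ADE type other than $A_1^{(1)}$; that is, $A$ is a symmetric integer matrix with $\langle i,i\rangle=2$ and $\langle i,j\rangle\le 0$ for $i\neq j$, which is either positive definite, or else indecomposable and positive semidefinite of corank one and, up to reordering of $I$, different from $\begin{pmatrix}2&-2\\-2&2\end{pmatrix}$. Work over $\mathbb Q(q)$, and for $n\in\mathbb N$ put $[n]=\frac{q^{-n}-q^{n}}{q^{-1}-q}$ and, for $n>0$, $[-n]=(-1)^{n+1}[n]$. Let $H=\mathrm{Sym}^{\otimes I}=\mathbb Q(q)[p_{n,i}\mid n\ge 1,\ i\in I]$ be the graded Hopf algebra in which $p_{n,i}$, the $n$-th power sum in the $i$-th tensor factor, is primitive of degree $n$. Equip it with the bilinear form that on monomials in the power sums is given by $$\Big\langle \prod_{r=1}^{\ell} p_{k_r,i_r},\ \prod_{r=1}^{\ell'} p_{l_r,j_r}\Big\rangle=\delta_{\ell,\ell'}\sum_{\sigma\in S_\ell}\prod_{r=1}^{\ell}\delta_{k_r,l_{\sigma(r)}}\,[k_r\langle i_r,j_{\sigma(r)}\rangle]\,\frac{[k_r]}{k_r}.$$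 For a partition $\lambda$ let $m_k(\lambda)$ be the number of its parts equal to $k$, and let $$h_{n,i}=\sum_{\lambda\vdash n}\ \prod_{k\ge1}\frac{p_{k,i}^{m_k(\lambda)}}{[k]^{m_k(\lambda)}\,m_k(\lambda)!}\quad(n\ge 0),\qquad h_{n,i}=0\quad(n<0),$$ the quantized complete symmetric functions; in particular $h_{0,i}=1$. Then $H^+=H$ and $H^-=H$ form a dual pair of graded Hopf algebras under this form: it is a Hopf pairing, pieces of different degree are orthogonal, and pieces of equal degree are perfectly paired. Let $\mathfrak h=\mathfrak h(H^+,H^-)$ be the Heisenberg double, i.e. $H^+\otimes H^-$, with $a\otimes x$ written $a\# x$, with product $$(a\# x)(b\# y)=\sum_{(x),(b)}\langle x_1,b_2\rangle\, a b_1\# x_2y .$$ Write $h_{n,i}$, $p_{n,i}$ for the elements $h_{n,i}\# 1$, $p_{n,i}\# 1$ of $\mathfrak h$, and $h'_{n,i}$, $p'_{n,i}$ for $1\# h_{n,i}$, $1\# p_{n,i}$. (a) The $\mathbb Q(q)$-algebra $\mathfrak h$ is presented by the generators $h_{n,i},h'_{n,i}$ ($n\in\mathbb N$, $i\in I$) with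 the conventions $h_{0,i}=h'_{0,i}=1$, $h_{n,i}=h'_{n,i}=0$ for $n<0$, and the following relations for all $n,m\in\mathbb N$ and $i,j\in I$: $$h_{n,i}h_{m,j}=h_{m,j}h_{n,i},\qquad h'_{n,i}h'_{m,j}=h'_{m,j}h'_{n,i},$$ $$h'_{n,i}h_{m,i}=\sum_{k\ge0}[k+1]\,h_{m-k,i}\,h'_{n-k,i},$$ $$h'_{n,i}h_{m,j}=h_{m,j}h'_{n,i}+h_{m-1,j}h'_{n-1,i}\quad\text{if }\langle i,j\rangle=-1,$$ $$h'_{n,i}h_{m,j}=h_{m,j}h'_{n,i}\quad\text{if }\langle i,j\rangle=0.$$ (b) All coefficients of these relations lie in $\mathbb Z[q,q^{-1}]$. (c) $\mathfrak h$ is also presented by the generators $p_{n,i},p'_{n,i}$ ($n\ge1$, $i\in I$) with the relations $$p_{m,i}p_{n,j}=p_{n,j}p_{m,i},\qquad p'_{m,i}p'_{n,j}=p'_{n,j}p'_{m,i},\qquad p'_{m,i}p_{n,j}=p_{n,j}p'_{m,i}+\delta_{m,n}[n\langle i,j\rangle]\frac{[n]}{n},$$ which for affine $A$ define the quantum toroidal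 Heisenberg algebra. Hence (a) is a presentation of that algebra; it is the Cautis--Licata presentation, with $h_{n,i}$, $h'_{n,i}$ in the roles of its generators $p_i^{(n)}$, $q_i^{(n)}$. -/

import Mathlib

open scoped TensorProduct

noncomputable section

namespace QHeis

/-! ## Dual pairs of Hopf algebras and the Heisenberg double -/

section HeisenbergDouble

variable {R Hm Hp : Type*} [CommRing R] [Ring Hm] [Ring Hp] [HopfAlgebra R Hm] [HopfAlgebra R Hp]

/-- The pairing `⟨x ⊗ y, a ⊗ b⟩ = ⟨x, a⟩ ⟨y, b⟩` induced on tensor squares. -/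
def tensorPairing (B : Hm →ₗ[R] Hp →ₗ[R] R) : Hm ⊗[R] Hm →ₗ[R] Hp ⊗[R] Hp →ₗ[R] R :=
  (TensorProduct.map₂ B B).compr₂ (LinearMap.mul' R R)

/-- An (untwisted) Hopf pairing `Hm × Hp → R`. -/
structure IsHopfPairing (B : Hm →ₗ[R] Hp →ₗ[R] R) : Prop where
  mul_left : ∀ (x y : Hm) (a : Hp), B (x * y) a = tensorPairing B (x ⊗ₜ y) (Coalgebra.comul a)
  mul_right : ∀ (x : Hm) (a b : Hp), B x (a * b) = tensorPairing B (Coalgebra.comul x) (a ⊗ₜ b)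
  one_left : ∀ a : Hp, B 1 a = Coalgebra.counit a
  one_right : ∀ x : Hm, B x 1 = Coalgebra.counit x

/-- `(Hp, Hm)`, graded by the submodules `Gm` and `Gp`, is a dual pair via `B`: the form is a Hopf
pairing, pieces of different degree are orthogonal, and the form is a perfect pairing between the
pieces of equal degree. -/
structure IsDualPair (Gm : ℕ → Submodule R Hm) (Gp : ℕ → Submodule R Hp)
    (B : Hm →ₗ[R] Hp →ₗ[R] R) : Prop where
  isHopfPairing : IsHopfPairing B
  orthogonal : ∀ m n : ℕ, m ≠ n → ∀ x ∈ Gm m, ∀ a ∈ Gp n, B x a = 0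
  perfect : ∀ n : ℕ, (B.domRestrict₁₂ (Gm n) (Gp n)).IsPerfPair

/-- The left regular action of `Hm` on `Hp`: `x^*(a) = ∑ ⟨x, a₂⟩ a₁`. -/
def leftRegular (B : Hm →ₗ[R] Hp →ₗ[R] R) : Hm →ₗ[R] Hp →ₗ[R] Hp where
  toFun x := (TensorProduct.rid R Hp).toLinearMap ∘ₗ (B x).lTensor Hp ∘ₗ Coalgebra.comul
  map_add' x y := by ext a; simp [LinearMap.lTensor_add]
  map_smul' c x := by ext a; simp [LinearMap.lTensor_smul]

/-- `x^*` is adjoint to right multiplication by `x`. -/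
theorem leftRegular_adjoint {B : Hm →ₗ[R] Hp →ₗ[R] R} (hB : IsHopfPairing B) (x y : Hm) (a : Hp) :
    B y (leftRegular B x a) = B (y * x) a := by
  rw [hB.mul_left]
  simp only [leftRegular, LinearMap.coe_mk, AddHom.coe_mk, LinearMap.comp_apply]
  generalize (Coalgebra.comul a : Hp ⊗[R] Hp) = t
  induction t with
  | zero => simp
  | add s t hs ht => simp only [map_add, hs, ht]
  | tmul b c => simp [tensorPairing, mul_comm]

/-- The element `∑ x₁^*(b) ⊗ x₂`, which is the product `x b` in the Heisenberg double. -/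
def exchange (B : Hm →ₗ[R] Hp →ₗ[R] R) (x : Hm) (b : Hp) : Hp ⊗[R] Hm :=
  TensorProduct.map ((leftRegular B).flip b) LinearMap.id (Coalgebra.comul x)

/-- The underlying module `Hp ⊗ Hm` of the Heisenberg double; `a ⊗ₜ x` is `a # x`. -/
def HeisenbergDouble (_B : Hm →ₗ[R] Hp →ₗ[R] R) : Type _ := Hp ⊗[R] Hm

instance (B : Hm →ₗ[R] Hp →ₗ[R] R) : AddCommGroup (HeisenbergDouble B) :=
  inferInstanceAs (AddCommGroup (Hp ⊗[R] Hm))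

instance (B : Hm →ₗ[R] Hp →ₗ[R] R) : Module R (HeisenbergDouble B) :=
  inferInstanceAs (Module R (Hp ⊗[R] Hm))

/-- The element `a # x` of the Heisenberg double. -/
def smash (B : Hm →ₗ[R] Hp →ₗ[R] R) (a : Hp) (x : Hm) : HeisenbergDouble B := a ⊗ₜ[R] x

/-- The bilinear multiplication `(a # x)(b # y) = ∑ a x₁^*(b) # x₂ y`. The product
on the right-hand side of the defining formula is the one of the usual tensor product algebra. -/
def doubleMul (B : Hm →ₗ[R] Hp →ₗ[R] R) :
    Hp ⊗[R] Hm →ₗ[R] Hp ⊗[R] Hm →ₗ[R] Hp ⊗[R] Hm :=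
  TensorProduct.lift <| LinearMap.mk₂ R
    (fun (a : Hp) (x : Hm) => TensorProduct.lift <| LinearMap.mk₂ R
      (fun (b : Hp) (y : Hm) => (a ⊗ₜ[R] (1 : Hm)) * exchange B x b * ((1 : Hp) ⊗ₜ[R] y))
      (fun b b' y => by simp [exchange, TensorProduct.map_add_left, mul_add, add_mul])
      (fun c b y => by simp [exchange, TensorProduct.map_smul_left])
      (fun b y y' => by simp [TensorProduct.tmul_add, mul_add])
      (fun c b y => by simp))
    (fun a a' x => by
      ext b y; simp [TensorProduct.add_tmul, add_mul]; rfl)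
    (fun c a x => by
      ext b y; simp [← TensorProduct.smul_tmul']; rfl)
    (fun a x x' => by
      ext b y; simp [exchange, mul_add, add_mul])
    (fun c a x => by
      ext b y; simp [exchange])

instance (B : Hm →ₗ[R] Hp →ₗ[R] R) : Mul (HeisenbergDouble B) := ⟨fun u v => doubleMul B u v⟩

instance (B : Hm →ₗ[R] Hp →ₗ[R] R) : One (HeisenbergDouble B) := ⟨smash B 1 1⟩

theorem smash_mul_smash (B : Hm →ₗ[R] Hp →ₗ[R] R) (a b : Hp) (x y : Hm) :
    smash B a x * smash B b y =
      ((a ⊗ₜ[R] (1 : Hm)) * exchange B x b * ((1 : Hp) ⊗ₜ[R] y) : Hp ⊗[R] Hm) :=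
  rfl

end HeisenbergDouble

/-! ## Quantum integers -/

/-- The field `ℚ(q)`. -/
abbrev K : Type := RatFunc ℚ

/-- The indeterminate `q`. -/
abbrev q : K := RatFunc.X

/-- `[n] = (q^{-n} - q^n) / (q^{-1} - q)` for `n ≥ 0`, and `[-n] = (-1)^{n+1} [n]` for `n > 0`. -/
def qint (n : ℤ) : K :=
  if 0 ≤ n then (q ^ (-n) - q ^ n) / (q⁻¹ - q)
  else (-1) ^ (n.natAbs + 1) * ((q ^ n - q ^ (-n)) / (q⁻¹ - q))

/-! ## The Hopf algebra `Sym^{⊗ I}` -/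

section Sym

/-- The Hopf algebra `Sym^{⊗ I}` over `ℚ(q)` as the polynomial algebra in the power sums: the
variable `(n, i)` is the `n`-th power sum in the `i`-th tensor factor. (A `def`, so that the
coalgebra structure of the monoid algebra underlying `MvPolynomial`, with group-like monomials, is
not picked up.) -/
def SymPow (I : Type*) : Type _ := MvPolynomial (ℕ+ × I) K

instance (I : Type*) : CommRing (SymPow I) := inferInstanceAs (CommRing (MvPolynomial (ℕ+ × I) K))

instance (I : Type*) : Algebra K (SymPow I) := inferInstanceAs (Algebra K (MvPolynomial (ℕ+ × I) K))

/-- `SymPow I` as a polynomial algebra. -/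
def SymPow.equiv (I : Type*) : SymPow I ≃ₐ[K] MvPolynomial (ℕ+ × I) K := AlgEquiv.refl

/-- The power sum with index `s = (n, i)`, `n ≥ 1`. -/
def SymPow.X {I : Type*} (s : ℕ+ × I) : SymPow I := (SymPow.equiv I).symm (MvPolynomial.X s)

/-- The algebra homomorphism with prescribed values on the power sums. -/
def SymPow.lift {I B : Type*} [CommRing B] [Algebra K B] (f : ℕ+ × I → B) : SymPow I →ₐ[K] B :=
  (MvPolynomial.aeval f).comp (SymPow.equiv I).toAlgHom

@[simp]
theorem SymPow.lift_X {I B : Type*} [CommRing B] [Algebra K B] (f : ℕ+ × I → B) (s : ℕ+ × I) :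
    SymPow.lift f (SymPow.X s) = f s := by
  simp [SymPow.lift, SymPow.X]

theorem SymPow.algHom_ext {I B : Type*} [Semiring B] [Algebra K B] {f g : SymPow I →ₐ[K] B}
    (hfg : ∀ s, f (SymPow.X s) = g (SymPow.X s)) : f = g :=
  MvPolynomial.algHom_ext (A := B) (f := f) (g := g) hfg

/-- The comultiplication: the power sums are primitive. -/
def symComul (I : Type*) : SymPow I →ₐ[K] SymPow I ⊗[K] SymPow I :=
  SymPow.lift fun s => SymPow.X s ⊗ₜ 1 + 1 ⊗ₜ SymPow.X s

def symCounit (I : Type*) : SymPow I →ₐ[K] K := SymPow.lift fun _ => 0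

def symAntipode (I : Type*) : SymPow I →ₐ[K] SymPow I := SymPow.lift fun s => -SymPow.X s

instance symBialgebra (I : Type*) : Bialgebra K (SymPow I) :=
  Bialgebra.ofAlgHom (symComul I) (symCounit I)
    (by
      refine SymPow.algHom_ext fun s => ?_
      simp [symComul, TensorProduct.tmul_add, TensorProduct.add_tmul, Algebra.TensorProduct.one_def,
        add_assoc])
    (by refine SymPow.algHom_ext fun s => ?_; simp [symComul, symCounit])
    (by refine SymPow.algHom_ext fun s => ?_; simp [symComul, symCounit])

instance symHopfAlgebra (I : Type*) : HopfAlgebra K (SymPow I) :=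
  HopfAlgebra.ofAlgHom (symAntipode I)
    (by
      refine SymPow.algHom_ext fun s => ?_
      change Algebra.TensorProduct.lift (symAntipode I) (.id K _) (fun _ _ => Commute.all _ _)
        (symComul I (SymPow.X s)) = algebraMap K (SymPow I) (symCounit I (SymPow.X s))
      simp [symComul, symCounit, symAntipode])
    (by
      refine SymPow.algHom_ext fun s => ?_
      change Algebra.TensorProduct.lift (.id K _) (symAntipode I) (fun _ _ => Commute.all _ _)
        (symComul I (SymPow.X s)) = algebraMap K (SymPow I) (symCounit I (SymPow.X s))
      simp [symComul, symCounit, symAntipode])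

/-- The part of degree `n` of `Sym^{⊗ I}`, where `p_{k,i}` has degree `k`. -/
def symDegree (I : Type*) (n : ℕ) : Submodule K (SymPow I) :=
  (MvPolynomial.weightedHomogeneousSubmodule K (fun s : ℕ+ × I => (s.1 : ℕ)) n).comap
    (SymPow.equiv I).toLinearMap

/-- The basis of monomials in the power sums, indexed by exponent vectors. -/
def symBasis (I : Type*) : Module.Basis (ℕ+ × I →₀ ℕ) K (SymPow I) :=
  (MvPolynomial.basisMonomials (ℕ+ × I) K).map (SymPow.equiv I).symm.toLinearEquiv

variable {I : Type*}

/-- The power sum `p_{n,i}`, with `p_{0,i} = 1`. -/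
def p (n : ℕ) (i : I) : SymPow I :=
  if hn : 0 < n then SymPow.X (⟨n, hn⟩, i) else 1

/-- `Z_λ = ∏_k [k]^{m_k(λ)} m_k(λ)!`. -/
def Z {n : ℕ} (l : n.Partition) : K :=
  ∏ k ∈ l.parts.toFinset, qint k ^ l.parts.count k * ((l.parts.count k).factorial : K)

/-- `h_{n,i} = ∑_{λ ⊢ n} p_{λ,i} / Z_λ`, where `p_{λ,i} = ∏_k p_{λ_k,i}`. -/
def h (n : ℕ) (i : I) : SymPow I :=
  ∑ l : n.Partition, (Z l)⁻¹ • (l.parts.map fun k => p k i).prod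

/-- `δ_{m,n} [m ⟨i,j⟩] [m] / m`, the pairing of `p_{m,i}` with `p_{n,j}`. -/
def genPairing (A : Matrix I I ℤ) (s t : ℕ+ × I) : K :=
  if s.1 = t.1 then
    qint (((s.1 : ℕ) : ℤ) * A s.2 t.2) * (qint ((s.1 : ℕ) : ℤ) / ((s.1 : ℕ) : K))
  else 0

/-- The sum over `σ ∈ S_ℓ` of `∏_r ⟨u_r, v_{σ(r)}⟩` if `u` and `v` have the same length `ℓ`, and `0`
otherwise. -/
def seqPairing (A : Matrix I I ℤ) (u v : List (ℕ+ × I)) : K :=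
  if hl : u.length = v.length then
    ∑ σ : Equiv.Perm (Fin u.length),
      ∏ r : Fin u.length, genPairing A (u.get r) (v.get (Fin.cast hl (σ r)))
  else 0

/-- The bilinear form on `Sym^{⊗ I}`, given on the basis of the `p_λ`, `λ` an `I`-tuple of
partitions, by the sum over permutations above. Such a `λ` is the same as an exponent vector `e`
of the variables `p_{k,i}`, where `e (k, i)` is the multiplicity of `k` in `λ^i`; the sequence of
its coloured parts is listed in an arbitrary order, which does not affect the sum. -/
def form (A : Matrix I I ℤ) : SymPow I →ₗ[K] SymPow I →ₗ[K] K :=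
  (symBasis I).constr K fun e => (symBasis I).constr K fun f =>
    seqPairing A (Finsupp.toMultiset e).toList (Finsupp.toMultiset f).toList

/-- The Heisenberg double of `H⁺ = H⁻ = Sym^{⊗ I}` with respect to the form `form A`. -/
abbrev SymDouble (A : Matrix I I ℤ) : Type _ := HeisenbergDouble (form A)

end Sym

/-! ## Cartan matrices -/

section Cartan

variable {I : Type*}

/-- Symmetric generalized Cartan matrices. -/
structure IsSymmetricGCM (A : Matrix I I ℤ) : Prop where
  symm : A.IsSymm
  diag : ∀ i, A i i = 2
  offDiag : ∀ i j, i ≠ j → A i j ≤ 0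

/-- `A` is not, after a permutation of the indices, block diagonal with two non-empty blocks. -/
def IsIndecomposable (A : Matrix I I ℤ) : Prop :=
  ∀ S : Set I, S.Nonempty → Sᶜ.Nonempty → ∃ i ∈ S, ∃ j ∈ Sᶜ, A i j ≠ 0

/-- Cartan matrices of finite ADE type: symmetric generalized Cartan matrices of finite type, i.e.
positive definite ones (the types `A_n`, `D_n`, `E_6`, `E_7`, `E_8` and their disjoint unions). -/
def IsFiniteADE [Fintype I] (A : Matrix I I ℤ) : Prop :=
  IsSymmetricGCM A ∧ (A.map (fun z : ℤ => (z : ℝ))).PosDef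

/-- Cartan matrices of affine ADE type: symmetric generalized Cartan matrices of affine type, i.e.
indecomposable, positive semidefinite and of corank one (the types `A_n^{(1)}`, `D_n^{(1)}`,
`E_6^{(1)}`, `E_7^{(1)}`, `E_8^{(1)}`). -/
def IsAffineADE [Fintype I] (A : Matrix I I ℤ) : Prop :=
  IsSymmetricGCM A ∧ IsIndecomposable A ∧ (A.map (fun z : ℤ => (z : ℝ))).PosSemidef ∧
    (A.map (fun z : ℤ => (z : ℝ))).rank + 1 = Fintype.card I

/-- Type `A_1^{(1)}`: two vertices joined by a double edge. -/
def IsTypeA11 (A : Matrix I I ℤ) : Prop :=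
  ∃ e : I ≃ Fin 2, A.reindex e e = !![2, -2; -2, 2]

end Cartan

/-! ## The two presentations -/

section Presentations

variable {I : Type*}

/-- Generators `plus n i` and `minus n i` (the primed ones). -/
inductive Gen (N I : Type*) : Type _
  | plus (n : N) (i : I) : Gen N I
  | minus (n : N) (i : I) : Gen N I

/-- The free generator `h_{n,i}`, with `h_{n,i} = 0` for `n < 0`. -/
def hFree (n : ℤ) (i : I) : FreeAlgebra K (Gen ℕ I) :=
  if n < 0 then 0 else FreeAlgebra.ι K (Gen.plus n.toNat i)

/-- The free generator `h'_{n,i}`, with `h'_{n,i} = 0` for `n < 0`. -/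
def hFree' (n : ℤ) (i : I) : FreeAlgebra K (Gen ℕ I) :=
  if n < 0 then 0 else FreeAlgebra.ι K (Gen.minus n.toNat i)

/-- The relations between the `h_{n,i}` and `h'_{n,i}`. In the third commutation relation the terms
with `k > n` vanish. -/
inductive HRel (A : Matrix I I ℤ) : FreeAlgebra K (Gen ℕ I) → FreeAlgebra K (Gen ℕ I) → Prop
  | h_zero (i : I) : HRel A (hFree 0 i) 1
  | h_zero' (i : I) : HRel A (hFree' 0 i) 1
  | h_comm (n m : ℕ) (i j : I) : HRel A (hFree n i * hFree m j) (hFree m j * hFree n i)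
  | h_comm' (n m : ℕ) (i j : I) : HRel A (hFree' n i * hFree' m j) (hFree' m j * hFree' n i)
  | same (n m : ℕ) (i : I) :
      HRel A (hFree' n i * hFree m i)
        (∑ k ∈ Finset.range (n + 1),
          qint ((k : ℤ) + 1) • (hFree ((m : ℤ) - k) i * hFree' ((n : ℤ) - k) i))
  | adjacent (n m : ℕ) (i j : I) (hij : A i j = -1) :
      HRel A (hFree' n i * hFree m j)
        (hFree m j * hFree' n i + hFree ((m : ℤ) - 1) j * hFree' ((n : ℤ) - 1) i)
  | distant (n m : ℕ) (i j : I) (hij : A i j = 0) :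
      HRel A (hFree' n i * hFree m j) (hFree m j * hFree' n i)

/-- The algebra with generators `h_{n,i}`, `h'_{n,i}` and the relations above. -/
abbrev HAlgebra (A : Matrix I I ℤ) : Type _ := RingQuot (HRel A)

def HAlgebra.gen (A : Matrix I I ℤ) (n : ℕ) (i : I) : HAlgebra A :=
  RingQuot.mkAlgHom K (HRel A) (FreeAlgebra.ι K (Gen.plus n i))

def HAlgebra.gen' (A : Matrix I I ℤ) (n : ℕ) (i : I) : HAlgebra A :=
  RingQuot.mkAlgHom K (HRel A) (FreeAlgebra.ι K (Gen.minus n i))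

/-- The relations between the `p_{n,i}` and `p'_{n,i}`, `n ≥ 1`. -/
inductive PRel (A : Matrix I I ℤ) : FreeAlgebra K (Gen ℕ+ I) → FreeAlgebra K (Gen ℕ+ I) → Prop
  | p_comm (m n : ℕ+) (i j : I) :
      PRel A (FreeAlgebra.ι K (Gen.plus m i) * FreeAlgebra.ι K (Gen.plus n j))
        (FreeAlgebra.ι K (Gen.plus n j) * FreeAlgebra.ι K (Gen.plus m i))
  | p_comm' (m n : ℕ+) (i j : I) :
      PRel A (FreeAlgebra.ι K (Gen.minus m i) * FreeAlgebra.ι K (Gen.minus n j))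
        (FreeAlgebra.ι K (Gen.minus n j) * FreeAlgebra.ι K (Gen.minus m i))
  | p_mixed (m n : ℕ+) (i j : I) :
      PRel A (FreeAlgebra.ι K (Gen.minus m i) * FreeAlgebra.ι K (Gen.plus n j))
        (FreeAlgebra.ι K (Gen.plus n j) * FreeAlgebra.ι K (Gen.minus m i) +
          algebraMap K _ (if m = n then
            qint (((n : ℕ) : ℤ) * A i j) * (qint ((n : ℕ) : ℤ) / ((n : ℕ) : K)) else 0))

/-- The quantum (toroidal) Heisenberg algebra, with generators `p_{n,i}`, `p'_{n,i}`. -/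
abbrev QuantumToroidal (A : Matrix I I ℤ) : Type _ := RingQuot (PRel A)

def QuantumToroidal.gen (A : Matrix I I ℤ) (n : ℕ+) (i : I) : QuantumToroidal A :=
  RingQuot.mkAlgHom K (PRel A) (FreeAlgebra.ι K (Gen.plus n i))

def QuantumToroidal.gen' (A : Matrix I I ℤ) (n : ℕ+) (i : I) : QuantumToroidal A :=
  RingQuot.mkAlgHom K (PRel A) (FreeAlgebra.ι K (Gen.minus n i))

end Presentations

end QHeis

end

/-! Everything rests on Fock space. Let `Sym^{⊗ I}` act on itself so that `p_s` becomes the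
derivation `p_t ↦ ⟨p_s, p_t⟩`. By Wick's formula the constant term of `fock A x y` is the given form
(`form_apply`). Hence the form is a Hopf pairing, `fock` is the left regular action that defines the
double, and multiplication by `p_t` is adjoint to annihilation (`form_X_mul`).

The Cartan type enters only through `IsSimplyLaced`: off-diagonal entries are `0` or `-1`. Then the
Gram matrix of the power sums of degree `n` is a nonzero scalar times a polynomial matrix that is
the identity at `q = 0`. So the form is nondegenerate, which gives the dual pair.

For the presentation by power sums, normal ordering `a # x ↦ a x` maps the double multiplicatively
onto the presented algebra. It is injective because normally ordered elements act faithfully on Fock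
space (`ordered_injective`), by nondegeneracy.

For the presentation by the `h_{n,i}`, the series `∑ h_{n,i} z^n` is `exp (∑ p_{k,i} z^k / [k])`. It
is group-like, so `h'_n` moves past `h_m` with coefficients `⟨h_{k,i}, h_{k,j}⟩`. These have the
generating series `exp (∑ [k⟨i,j⟩] z^k / (k [k]))`, which is `1 / ((1 - q z)(1 - q⁻¹ z))`, `1 + z`
or `1` for `⟨i,j⟩ = 2, -1, 0`: exactly the stated relations. This yields `toToroidal`. Since the
`h_{n,i}` with `n ≥ 1` generate `Sym^{⊗ I}` freely, both halves map into `HAlgebra A`; their ordered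
products span it and have linearly independent images, so `toToroidal` is bijective. -/

noncomputable section
namespace QHeis

/-! ### Maps and derivations out of the polynomial algebra in the power sums -/

section Lift

universe u

variable {I : Type*}

theorem SymPow.induction {P : SymPow I → Prop} (a : SymPow I)
    (scalar : ∀ c : K, P (algebraMap K (SymPow I) c))
    (add : ∀ a b, P a → P b → P (a + b))
    (X_mul : ∀ s a, P a → P (SymPow.X s * a)) : P a :=
  MvPolynomial.induction_on (motive := P) a scalar add fun a s ha => by
    rw [mul_comm]; exact X_mul s a ha

/-- A commuting family in an algebra comes from a family in a commutative algebra. -/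
theorem exists_commRing_of_commute {S : Type*} {B : Type u} [Ring B] [Algebra K B] (f : S → B)
    (hf : ∀ s t, f s * f t = f t * f s) :
    ∃ (C : Type u) (_ : CommRing C) (_ : Algebra K C) (ι : C →ₐ[K] B) (g : S → C),
      Function.Injective ι ∧ ∀ s, ι (g s) = f s := by
  have hcomm : IsMulCommutative (Algebra.adjoin K (Set.range f)) :=
    Algebra.isMulCommutative_adjoin K (by rintro _ ⟨s, rfl⟩ _ ⟨t, rfl⟩; exact hf s t)
  let R : CommRing (Algebra.adjoin K (Set.range f)) :=
    { (inferInstance : Ring (Algebra.adjoin K (Set.range f))) with mul_comm := mul_comm' }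
  exact ⟨Algebra.adjoin K (Set.range f), R, inferInstance, (Algebra.adjoin K (Set.range f)).val,
    fun s => ⟨f s, Algebra.subset_adjoin ⟨s, rfl⟩⟩, Subtype.val_injective, fun s => rfl⟩

/-- The algebra homomorphism into a noncommutative algebra with prescribed commuting values on the
power sums. -/
theorem SymPow.exists_algHom_of_commute {B : Type*} [Ring B] [Algebra K B] (f : ℕ+ × I → B)
    (hf : ∀ s t, f s * f t = f t * f s) : ∃ F : SymPow I →ₐ[K] B, ∀ s, F (SymPow.X s) = f s := by
  obtain ⟨C, _, _, ι, g, -, hg⟩ := exists_commRing_of_commute f hf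
  exact ⟨ι.comp (SymPow.lift g), fun s => by simp [hg]⟩

/-- The derivation with prescribed values on the power sums. -/
def SymPow.mkDerivation (f : ℕ+ × I → SymPow I) : Derivation K (SymPow I) (SymPow I) :=
  (MvPolynomial.mkDerivation K f : Derivation K (MvPolynomial (ℕ+ × I) K) (MvPolynomial (ℕ+ × I) K))

@[simp]
theorem SymPow.mkDerivation_X (f : ℕ+ × I → SymPow I) (s : ℕ+ × I) :
    SymPow.mkDerivation f (SymPow.X s) = f s :=
  MvPolynomial.mkDerivation_X K (A := MvPolynomial (ℕ+ × I) K) f s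

theorem SymPow.derivation_ext {D E : Derivation K (SymPow I) (SymPow I)}
    (hDE : ∀ s, D (SymPow.X s) = E (SymPow.X s)) : D = E :=
  MvPolynomial.derivation_ext (A := MvPolynomial (ℕ+ × I) K) hDE

end Lift

/-! ### The Fock action and Wick's formula for the form -/

section Annihilation

variable {I : Type*} (A : Matrix I I ℤ)

/-- The annihilation operator of the power sum `s`: the derivation with `p_t ↦ ⟨p_s, p_t⟩`. -/
def annihilation (s : ℕ+ × I) : Derivation K (SymPow I) (SymPow I) :=
  SymPow.mkDerivation fun t => algebraMap K _ (genPairing A s t)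

@[simp]
theorem annihilation_X (s t : ℕ+ × I) :
    annihilation A s (SymPow.X t) = algebraMap K _ (genPairing A s t) := by
  simp [annihilation]

/-- The commutator is a derivation, and it kills generators because each annihilation operator sends
them to scalars. -/
theorem annihilation_comm (s t : ℕ+ × I) (a : SymPow I) :
    annihilation A s (annihilation A t a) = annihilation A t (annihilation A s a) := by
  have : ⁅annihilation A s, annihilation A t⁆ = 0 :=
    SymPow.derivation_ext fun r => by simp [Derivation.commutator_apply]
  have := DFunLike.congr_fun this a
  rwa [Derivation.commutator_apply, Derivation.zero_apply, sub_eq_zero] at this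

theorem exists_annihilationAlgHom : ∃ F : SymPow I →ₐ[K] Module.End K (SymPow I),
    ∀ s, F (SymPow.X s) = (annihilation A s : SymPow I →ₗ[K] SymPow I) :=
  SymPow.exists_algHom_of_commute _ fun s t => LinearMap.ext fun a => annihilation_comm A s t a

/-- The action of `Sym^{⊗ I}` on itself in which power sums act by annihilation operators. -/
def fock : SymPow I →ₐ[K] Module.End K (SymPow I) := (exists_annihilationAlgHom A).choose

@[simp]
theorem fock_X (s : ℕ+ × I) (a : SymPow I) : fock A (SymPow.X s) a = annihilation A s a := by
  rw [fock, (exists_annihilationAlgHom A).choose_spec s]; rfl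

@[simp]
theorem fock_X_mul (s : ℕ+ × I) (x a : SymPow I) :
    fock A (SymPow.X s * x) a = annihilation A s (fock A x a) := by
  rw [map_mul, Module.End.mul_apply, fock_X]

@[simp]
theorem symCounit_X (s : ℕ+ × I) : symCounit I (SymPow.X s) = 0 := by simp [symCounit]

@[simp]
theorem symComul_X (s : ℕ+ × I) :
    symComul I (SymPow.X s) = SymPow.X s ⊗ₜ 1 + 1 ⊗ₜ SymPow.X s := by simp [symComul]

/-- Leibniz rule. The remaining factors are indexed through `Equiv.swap 0 r` to agree with
`Equiv.Perm.decomposeFin`, used in the induction for Wick's formula. -/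
theorem annihilation_prod (s : ℕ+ × I) {n : ℕ} (v : Fin (n + 1) → ℕ+ × I) :
    annihilation A s (∏ r, SymPow.X (v r)) =
      ∑ r, genPairing A s (v r) • ∏ k : Fin n, SymPow.X (v (Equiv.swap 0 r k.succ)) := by
  classical
  have h1 : ∀ t : Finset (Fin (n + 1)), annihilation A s (∏ r ∈ t, SymPow.X (v r)) =
      ∑ r ∈ t, genPairing A s (v r) • ∏ k ∈ t.erase r, SymPow.X (v k) := by
    intro t
    induction t using Finset.induction_on with
    | empty => simp
    | insert a t ha ih =>
      rw [Finset.prod_insert ha, Derivation.leibniz, ih, Finset.sum_insert ha,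
        Finset.erase_insert ha, annihilation_X, add_comm, smul_eq_mul, smul_eq_mul, mul_comm,
        Algebra.smul_def, Finset.mul_sum]
      congr 1
      refine Finset.sum_congr rfl fun r hr => ?_
      have : r ≠ a := fun h => ha (h ▸ hr)
      rw [Finset.erase_insert_of_ne this.symm, Finset.prod_insert (by simp [ha]), mul_smul_comm]
  rw [h1]
  refine Finset.sum_congr rfl fun r _ => ?_
  congr 1
  -- The swap exchanges `0` and `r`, so it carries the successors onto the complement of `r`.
  have : Finset.univ.erase r = (Finset.univ : Finset (Fin n)).image
      fun k => Equiv.swap 0 r k.succ := by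
    ext k
    simp only [Finset.mem_erase, Finset.mem_univ, and_true, Finset.mem_image, true_and]
    constructor
    · intro hk
      have h0 : Equiv.swap 0 r k ≠ 0 := by
        rw [Ne, Equiv.swap_apply_eq_iff]; simpa using hk
      obtain ⟨j, hj⟩ := Fin.exists_succ_eq.2 h0
      exact ⟨j, by rw [hj]; simp⟩
    · rintro ⟨j, rfl⟩
      rw [Ne, Equiv.swap_apply_eq_iff, Equiv.swap_apply_right]
      exact Fin.succ_ne_zero j
  rw [this, Finset.prod_image]
  intro a _ b _ hab
  simpa using hab

/-- Wick's formula: the annihilator of `u 0` contracts with some `v r`, and this `r` is the value at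
`0` of the permutation. -/
theorem symCounit_fock_prod {n : ℕ} (u v : Fin n → ℕ+ × I) :
    symCounit I (fock A (∏ r, SymPow.X (u r)) (∏ r, SymPow.X (v r))) =
      ∑ σ : Equiv.Perm (Fin n), ∏ r, genPairing A (u r) (v (σ r)) := by
  induction n with
  | zero => simp
  | succ n ih =>
    rw [Fin.prod_univ_succ, mul_comm, map_mul, Module.End.mul_apply, fock_X, annihilation_prod,
      map_sum, map_sum, ← Equiv.sum_comp (Equiv.Perm.decomposeFin.symm), Fintype.sum_prod_type]
    refine Finset.sum_congr rfl fun r _ => ?_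
    rw [map_smul, map_smul, ih (fun k => u k.succ) (fun k => v (Equiv.swap 0 r k.succ)),
      smul_eq_mul, Finset.mul_sum]
    refine Finset.sum_congr rfl fun σ _ => ?_
    rw [Fin.prod_univ_succ]
    simp

theorem symCounit_fock_prod_of_ne {m n : ℕ} (hmn : m ≠ n) (u : Fin m → ℕ+ × I)
    (v : Fin n → ℕ+ × I) :
    symCounit I (fock A (∏ r, SymPow.X (u r)) (∏ r, SymPow.X (v r))) = 0 := by
  induction m generalizing n with
  | zero =>
    obtain ⟨n, rfl⟩ := Nat.exists_eq_succ_of_ne_zero hmn.symm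
    simp [Fin.prod_univ_succ]
  | succ m ih =>
    rw [Fin.prod_univ_succ, mul_comm, map_mul, Module.End.mul_apply, fock_X]
    cases n with
    | zero => simp
    | succ n =>
      rw [annihilation_prod, map_sum, map_sum]
      refine Finset.sum_eq_zero fun r _ => ?_
      rw [map_smul, map_smul, ih (fun h => hmn (by rw [h])), smul_zero]

theorem symBasis_apply (e : ℕ+ × I →₀ ℕ) :
    symBasis I e = ∏ r, SymPow.X ((Finsupp.toMultiset e).toList.get r) := by
  have h1 : ∀ l : List (ℕ+ × I), ∏ r, SymPow.X (l.get r) = (l.map SymPow.X).prod := fun l => by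
    rw [← List.prod_ofFn]; congr 1
    conv_rhs => rw [← List.ofFn_get l, List.map_ofFn]
    rfl
  rw [h1, ← Multiset.prod_coe, ← Multiset.map_coe, Multiset.coe_toList]
  have : (symBasis I e : SymPow I) = (SymPow.equiv I).symm (MvPolynomial.monomial e 1) := by
    simp [symBasis]
  rw [this, MvPolynomial.monomial_eq, map_one, one_mul, Finsupp.prod, map_prod,
    Finsupp.toMultiset_map, Finsupp.prod_toMultiset]
  rw [Finsupp.prod_mapDomain_index (by simp) (by intros; rw [pow_add])]
  simp [Finsupp.prod, SymPow.X]

theorem form_apply (x y : SymPow I) : form A x y = symCounit I (fock A x y) := by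
  have : form A = LinearMap.compr₂ (fock A).toLinearMap (symCounit I).toLinearMap := by
    refine (symBasis I).ext fun e => (symBasis I).ext fun f => ?_
    rw [form, Module.Basis.constr_basis, Module.Basis.constr_basis, LinearMap.compr₂_apply]
    simp only [AlgHom.toLinearMap_apply]
    rw [symBasis_apply, symBasis_apply, seqPairing]
    split_ifs with hl
    · rw [← Equiv.prod_comp (finCongr hl), symCounit_fock_prod]
      rfl
    · rw [symCounit_fock_prod_of_ne A hl]
  rw [this]; rfl

end Annihilation

/-! ### Compatibility of the Fock action with the Hopf structure -/

section Coproduct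

variable {I : Type*} (A : Matrix I I ℤ)

/-- Both sides are derivations along the coproduct, and on a primitive generator both give the same
scalar. The right tensor factor is the one contracted by `leftRegular`. -/
theorem symComul_annihilation (s : ℕ+ × I) (a : SymPow I) :
    symComul I (annihilation A s a) =
      (annihilation A s : SymPow I →ₗ[K] SymPow I).lTensor (SymPow I) (symComul I a) := by
  induction a using SymPow.induction with
  | scalar c =>
    rw [Derivation.map_algebraMap, map_zero, AlgHom.commutes, Algebra.TensorProduct.algebraMap_apply]
    simp
  | add a b ha hb => simp only [map_add, ha, hb]
  | X_mul t a ih =>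
    rw [Derivation.leibniz, annihilation_X, map_add, smul_eq_mul, smul_eq_mul, map_mul, map_mul, ih,
      map_mul, symComul_X, AlgHom.commutes]
    generalize symComul I a = w
    induction w with
    | zero => simp
    | add v w hv hw =>
      simp only [mul_add, map_add] at hv hw ⊢
      rw [← hv, ← hw]; ring
    | tmul b c =>
      simp [add_mul, TensorProduct.tmul_add, Algebra.algebraMap_eq_smul_one, add_assoc]

theorem symComul_fock (x a : SymPow I) :
    symComul I (fock A x a) = (fock A x).lTensor (SymPow I) (symComul I a) := by
  induction x using SymPow.induction with
  | scalar c => simp [Algebra.algebraMap_eq_smul_one, Module.End.one_eq_id, LinearMap.lTensor_smul]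
  | add x y hx hy => simp [hx, hy, LinearMap.lTensor_add]
  | X_mul s x ih =>
    rw [fock_X_mul, symComul_annihilation, ih, ← LinearMap.lTensor_comp_apply]
    congr 2
    ext b
    simp

/-- Apply the counit to the right factor of `symComul_fock`. -/
theorem leftRegular_form (x a : SymPow I) : leftRegular (form A) x a = fock A x a := by
  have h1 : form A x = (symCounit I).toLinearMap ∘ₗ fock A x :=
    LinearMap.ext fun a => form_apply A x a
  have h2 : (symCounit I).toLinearMap.lTensor (SymPow I) (symComul I (fock A x a)) =
      fock A x a ⊗ₜ[K] 1 := Coalgebra.lTensor_counit_comul (fock A x a)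
  change TensorProduct.rid K (SymPow I) ((form A x).lTensor (SymPow I) (symComul I a)) = _
  rw [h1, LinearMap.lTensor_comp_apply, ← symComul_fock, h2]
  simp

/-- Primitive elements act by derivations, so the Fock action makes `Sym^{⊗ I}` a module algebra. -/
theorem fock_mul (x a b : SymPow I) :
    fock A x (a * b) = LinearMap.mul' K (SymPow I) (TensorProduct.map
      ((fock A).toLinearMap.flip a) ((fock A).toLinearMap.flip b) (symComul I x)) := by
  induction x using SymPow.induction with
  | scalar c =>
    rw [AlgHom.commutes, AlgHom.commutes, Algebra.TensorProduct.algebraMap_apply]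
    simp [Algebra.algebraMap_eq_smul_one]
  | add x y hx hy => simp [hx, hy]
  | X_mul s x ih =>
    rw [fock_X_mul, ih, map_mul, symComul_X]
    generalize symComul I x = w
    induction w with
    | zero => simp
    | add v w hv hw => simp only [map_add, mul_add, hv, hw]
    | tmul y z => simp [add_mul, mul_comm (annihilation A s _), add_comm]

/-- The commutator of the operator of `x` with multiplication by `p_t` differentiates `x`. Symmetry
identifies `⟨p_s, p_t⟩`, produced on the right argument, with `⟨p_t, p_s⟩`. -/
theorem fock_X_mul_apply (hA : A.IsSymm) (t : ℕ+ × I) (x a : SymPow I) :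
    fock A x (SymPow.X t * a) = SymPow.X t * fock A x a + fock A (annihilation A t x) a := by
  induction x using SymPow.induction with
  | scalar c => simp [Algebra.algebraMap_eq_smul_one]
  | add x y hx hy => simp only [map_add, LinearMap.add_apply, hx, hy]; ring
  | X_mul s x ih =>
    have : genPairing A t s = genPairing A s t := by
      unfold genPairing
      split_ifs with h1 h2 h2
      · rw [h1, hA.apply]
      · exact absurd h1.symm h2
      · exact absurd h2.symm h1
      · rfl
    simp only [fock_X_mul, ih, map_add, Derivation.leibniz, annihilation_X, smul_eq_mul,
      Algebra.algebraMap_eq_smul_one, mul_smul_comm, mul_one, map_smul, LinearMap.add_apply,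
      LinearMap.smul_apply, this]
    ring

theorem form_X_mul (hA : A.IsSymm) (t : ℕ+ × I) (x a : SymPow I) :
    form A x (SymPow.X t * a) = form A (annihilation A t x) a := by
  rw [form_apply, form_apply, fock_X_mul_apply A hA]
  simp

theorem fock_one (x : SymPow I) : fock A x 1 = algebraMap K _ (symCounit I x) := by
  induction x using SymPow.induction with
  | scalar c => simp [Algebra.algebraMap_eq_smul_one]
  | add x y hx hy => simp [hx, hy]
  | X_mul s x ih => simp [ih]

theorem form_one_right (x : SymPow I) : form A x 1 = symCounit I x := by
  rw [form_apply, fock_one, AlgHom.commutes, Algebra.algebraMap_self, RingHom.id_apply]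

theorem isHopfPairing_form : IsHopfPairing (form A) where
  mul_left x y a := by
    rw [form_apply, map_mul, Module.End.mul_apply, ← leftRegular_form A y, ← form_apply]
    simp only [leftRegular, LinearMap.coe_mk, AddHom.coe_mk, LinearMap.comp_apply]
    generalize (Coalgebra.comul a : SymPow I ⊗[K] SymPow I) = t
    induction t with
    | zero => simp
    | add s t hs ht => simp only [map_add, hs, ht]
    | tmul b c => simp [tensorPairing, mul_comm]
  mul_right x a b := by
    rw [form_apply, fock_mul]
    change _ = tensorPairing (form A) (symComul I x) (a ⊗ₜ b)
    generalize symComul I x = t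
    induction t with
    | zero => simp
    | add s t hs ht => simp only [map_add, LinearMap.add_apply, hs, ht]
    | tmul y z => simp [tensorPairing, form_apply]
  one_left a := by rw [form_apply, map_one]; rfl
  one_right x := form_one_right A x

end Coproduct

/-! ### Quantum integers and nondegeneracy of the form -/

section Nondegenerate

theorem q_ne_zero : q ≠ 0 := RatFunc.X_ne_zero

theorem q_pow_ne_one {n : ℕ} (hn : n ≠ 0) : q ^ n ≠ 1 := fun h => by
  have h1 : (Polynomial.X : Polynomial ℚ) ^ n = 1 := by
    apply RatFunc.algebraMap_injective ℚ
    simpa using h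
  have := congrArg (Polynomial.eval 0) h1
  simp [hn] at this

theorem q_inv_sub_q_ne_zero : q⁻¹ - q ≠ 0 := fun h => by
  refine q_pow_ne_one two_ne_zero ?_
  have : q⁻¹ = q := sub_eq_zero.1 h
  rw [pow_two]; nth_rw 1 [← this]
  exact inv_mul_cancel₀ q_ne_zero

theorem qint_natCast (n : ℕ) : qint n = (q⁻¹ ^ n - q ^ n) / (q⁻¹ - q) := by
  simp [qint]

theorem qint_zero : qint 0 = 0 := by simp [qint]

theorem qint_neg (n : ℕ) : qint (-n) = (-1) ^ (n + 1) * qint n := by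
  rcases Nat.eq_zero_or_pos n with rfl | hn
  · simp [qint_zero]
  · rw [qint_natCast, qint, if_neg (by omega)]
    simp

theorem qint_ne_zero {n : ℕ} (hn : n ≠ 0) : qint n ≠ 0 := by
  rw [qint_natCast]
  refine div_ne_zero (fun h => q_pow_ne_one (n := 2 * n) (by omega) ?_) q_inv_sub_q_ne_zero
  have h1 : q⁻¹ ^ n = q ^ n := sub_eq_zero.1 h
  rw [two_mul, pow_add]; nth_rw 1 [← h1]
  rw [← mul_pow, inv_mul_cancel₀ q_ne_zero, one_pow]

theorem qint_mul_two (n : ℕ) : qint ((n : ℤ) * 2) = qint n * (q⁻¹ ^ n + q ^ n) := by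
  have : ((n : ℤ) * 2) = ((n * 2 : ℕ) : ℤ) := by push_cast; ring
  rw [this, qint_natCast, qint_natCast, pow_mul, pow_mul]
  ring

variable {I : Type*} (A : Matrix I I ℤ)

/-- The symmetric generalized Cartan matrices without multiple edges. -/
structure IsSimplyLaced : Prop where
  symm : A.IsSymm
  diag : ∀ i, A i i = 2
  offDiag : ∀ i j, i ≠ j → A i j = 0 ∨ A i j = -1

variable {A}

/-- After extracting `q⁻ⁿ [n]² / n`, the diagonal entries are `1 + q^{2n}` and the others `0` or `±
q^n`. Setting `q = 0` leaves the identity, so no definiteness of `A` is needed. -/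
theorem IsSimplyLaced.det_genPairing_ne_zero [Fintype I] [DecidableEq I] (hA : IsSimplyLaced A)
    (n : ℕ+) : (Matrix.of fun i j => genPairing A (n, i) (n, j)).det ≠ 0 := by
  let N : Matrix I I (Polynomial ℚ) := Matrix.of fun i j =>
    if i = j then Polynomial.X ^ (2 * (n : ℕ)) + 1 else
      if A i j = 0 then 0 else (-1) ^ ((n : ℕ) + 1) * Polynomial.X ^ (n : ℕ)
  have hn : (n : ℕ) ≠ 0 := n.ne_zero
  have hN : N.det ≠ 0 := fun h => by
    have h1 : (Polynomial.evalRingHom 0).mapMatrix N = 1 := by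
      ext i j
      by_cases hij : i = j
      · subst hij; simp [N, hn]
      · by_cases h0 : A i j = 0 <;> simp [N, hij, h0, hn]
    have h2 := RingHom.map_det (Polynomial.evalRingHom (0 : ℚ)) N
    rw [h1, h] at h2
    simp at h2
  have h3 : (Matrix.of fun i j => genPairing A (n, i) (n, j)) =
      (qint (n : ℕ) * (qint (n : ℕ) / (n : ℕ)) * q⁻¹ ^ (n : ℕ)) •
        (algebraMap (Polynomial ℚ) K).mapMatrix N := by
    ext i j
    have hq : q⁻¹ ^ (n : ℕ) * q ^ (n : ℕ) = 1 := by
      rw [← mul_pow, inv_mul_cancel₀ q_ne_zero, one_pow]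
    by_cases hij : i = j
    · subst hij
      simp only [Matrix.of_apply, genPairing, if_true, hA.diag, qint_mul_two, N, Matrix.smul_apply,
        RingHom.mapMatrix_apply, Matrix.map_apply, map_add, map_pow, map_one, RatFunc.algebraMap_X,
        smul_eq_mul, two_mul (n : ℕ), pow_add, map_mul]
      linear_combination (-qint (n : ℕ) * (qint (n : ℕ) / (n : ℕ)) * q ^ (n : ℕ)) * hq
    · rcases hA.offDiag i j hij with h0 | h0
      · simp [genPairing, N, hij, h0, qint_zero]
      · simp only [Matrix.of_apply, genPairing, if_true, h0, N, Matrix.smul_apply, if_neg hij,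
          RingHom.mapMatrix_apply, Matrix.map_apply, map_mul, map_pow, map_neg, map_one,
          RatFunc.algebraMap_X, smul_eq_mul, mul_neg, mul_one, qint_neg, neg_eq_zero, one_ne_zero,
          if_false]
        linear_combination
          (-qint (n : ℕ) * (qint (n : ℕ) / (n : ℕ)) * (-1) ^ ((n : ℕ) + 1)) * hq
  rw [h3, Matrix.det_smul, ← RingHom.map_det]
  refine mul_ne_zero (pow_ne_zero _ (mul_ne_zero (mul_ne_zero (qint_ne_zero hn)
    (div_ne_zero (qint_ne_zero hn) (by exact_mod_cast hn))) (pow_ne_zero _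
      (inv_ne_zero q_ne_zero)))) ?_
  rwa [Ne, FaithfulSMul.algebraMap_eq_zero_iff]

theorem sum_smul_derivation_apply {ι : Type*} (t : Finset ι) (c : ι → K)
    (D : ι → Derivation K (SymPow I) (SymPow I)) (a : SymPow I) :
    (∑ i ∈ t, c i • D i) a = ∑ i ∈ t, c i • D i a := by
  classical
  induction t using Finset.induction_on with
  | empty => simp
  | insert i t hi ih => rw [Finset.sum_insert hi, Finset.sum_insert hi, ← ih]; rfl

/-- Inverting the Gram matrix in degree `s.1` expresses partial derivatives through annihilation
operators. -/
theorem IsSimplyLaced.exists_pderiv_eq [Fintype I] (hA : IsSimplyLaced A) (s : ℕ+ × I) :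
    ∃ c : I → K, ∀ a : SymPow I, (MvPolynomial.pderiv s (SymPow.equiv I a)) =
      SymPow.equiv I (∑ i, c i • annihilation A (s.1, i) a) := by
  classical
  obtain ⟨n, j⟩ := s
  set M : Matrix I I K := Matrix.of fun i j => genPairing A (n, i) (n, j) with hM
  refine ⟨fun i => M⁻¹ j i, fun a => ?_⟩
  have h1 : SymPow.mkDerivation (Pi.single (n, j) 1) = ∑ i, M⁻¹ j i • annihilation A (n, i) := by
    refine SymPow.derivation_ext fun t => ?_
    obtain ⟨m, k⟩ := t
    rw [SymPow.mkDerivation_X]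
    simp only [sum_smul_derivation_apply, annihilation_X]
    by_cases hmn : n = m
    · subst hmn
      have h2 : ∑ i, M⁻¹ j i * genPairing A (n, i) (n, k) = (1 : Matrix I I K) j k := by
        rw [← Matrix.nonsing_inv_mul M (hA.det_genPairing_ne_zero n).isUnit, Matrix.mul_apply]
        rfl
      simp only [Algebra.algebraMap_eq_smul_one, smul_smul, ← Finset.sum_smul]
      rw [h2, Matrix.one_apply]
      by_cases hjk : j = k
      · subst hjk; simp
      · have : ((n, k) : ℕ+ × I) ≠ (n, j) := fun h => hjk (Prod.ext_iff.1 h).2.symm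
        simp [hjk, this]
    · have : ((m, k) : ℕ+ × I) ≠ (n, j) := fun h => hmn (Prod.ext_iff.1 h).1.symm
      simp [genPairing, hmn, this]
  have h2 := DFunLike.congr_fun h1 a
  rw [sum_smul_derivation_apply] at h2
  rw [← h2, MvPolynomial.pderiv_def]
  rfl

/-- The radical is stable under annihilation, hence under partial derivatives, and its elements have
constant term `⟨x, 1⟩ = 0`. In characteristic zero repeated differentiation then detects every
coefficient. -/
theorem IsSimplyLaced.form_nondegenerate [Fintype I] (hA : IsSimplyLaced A) {x : SymPow I}
    (hx : ∀ y, form A x y = 0) : x = 0 := by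
  have key : ∀ (d : ℕ) (e : ℕ+ × I →₀ ℕ) (x : SymPow I), e.degree = d →
      (∀ y, form A x y = 0) → (SymPow.equiv I x).coeff e = 0 := by
    intro d
    induction d with
    | zero =>
      intro e x he hx
      obtain rfl := (Finsupp.degree_eq_zero_iff e).1 he
      have h1 := hx 1
      rw [form_one_right] at h1
      rw [← h1]
      simp [symCounit, SymPow.lift, MvPolynomial.constantCoeff_eq]
    | succ d ih =>
      intro e x he hx
      have he0 : e ≠ 0 := by rintro rfl; simp at he
      obtain ⟨s, hs⟩ := Finsupp.ne_iff.1 he0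
      obtain ⟨f, rfl⟩ : ∃ f, e = f + Finsupp.single s 1 :=
        ⟨e - Finsupp.single s 1, (tsub_add_cancel_of_le (by
          rw [Finsupp.single_le_iff]; exact Nat.one_le_iff_ne_zero.2 hs)).symm⟩
      obtain ⟨c, hc⟩ := hA.exists_pderiv_eq s
      have h1 := ih f (∑ i, c i • annihilation A (s.1, i) x) (by
        simpa using he) (fun y => by
          rw [map_sum, LinearMap.sum_apply]
          refine Finset.sum_eq_zero fun i _ => ?_
          rw [map_smul, LinearMap.smul_apply, ← form_X_mul A hA.symm, hx, smul_zero])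
      rw [← hc, MvPolynomial.coeff_pderiv] at h1
      have h2 : ((f s : K) + 1) ≠ 0 := by exact_mod_cast Nat.succ_ne_zero (f s)
      simpa [h2] using h1
  apply (SymPow.equiv I).injective
  ext e
  simpa using key _ e x rfl hx

theorem form_comm (hA : A.IsSymm) (x y : SymPow I) : form A x y = form A y x := by
  induction y using SymPow.induction generalizing x with
  | scalar c =>
    rw [Algebra.algebraMap_eq_smul_one, map_smul, form_one_right, map_smul, LinearMap.smul_apply,
      form_apply A 1, map_one]
    rfl
  | add a b ha hb => rw [map_add, map_add, ha, hb, LinearMap.add_apply]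
  | X_mul t a ih =>
    rw [form_X_mul A hA, ih, form_apply, form_apply, mul_comm, map_mul, Module.End.mul_apply, fock_X]

end Nondegenerate

/-! ### The grading and perfectness in each degree -/

section Degree

variable {I : Type*} (A : Matrix I I ℤ)

theorem symBasis_mem_symDegree (e : ℕ+ × I →₀ ℕ) :
    symBasis I e ∈ symDegree I (Finsupp.weight (fun s : ℕ+ × I => (s.1 : ℕ)) e) := by
  have : SymPow.equiv I (symBasis I e) = MvPolynomial.monomial e 1 := by simp [symBasis]
  change SymPow.equiv I (symBasis I e) ∈ _
  rw [this]
  exact MvPolynomial.isWeightedHomogeneous_monomial _ _ _ rfl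

theorem symDegree_eq_span (n : ℕ) : symDegree I n = Submodule.span K
    (symBasis I '' {e | Finsupp.weight (fun s : ℕ+ × I => (s.1 : ℕ)) e = n}) := by
  refine le_antisymm (fun x hx => ?_) (Submodule.span_le.2 ?_)
  · have hx' : MvPolynomial.IsWeightedHomogeneous (fun s : ℕ+ × I => (s.1 : ℕ))
      (SymPow.equiv I x) n := hx
    rw [← (symBasis I).linearCombination_repr x, Finsupp.linearCombination_apply]
    refine Submodule.sum_mem _ fun e he => Submodule.smul_mem _ _ (Submodule.subset_span ⟨e, ?_, rfl⟩)
    exact hx' (Finsupp.mem_support_iff.1 he)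
  · rintro _ ⟨e, rfl, rfl⟩
    exact symBasis_mem_symDegree e

/-- A permutation with nonzero summand matches factors of equal degree, forcing equal total degrees.
-/
theorem form_symBasis_eq_zero (e f : ℕ+ × I →₀ ℕ)
    (hef : Finsupp.weight (fun s : ℕ+ × I => (s.1 : ℕ)) e ≠
      Finsupp.weight (fun s : ℕ+ × I => (s.1 : ℕ)) f) :
    form A (symBasis I e) (symBasis I f) = 0 := by
  have hw : ∀ e : ℕ+ × I →₀ ℕ, Finsupp.weight (fun s : ℕ+ × I => (s.1 : ℕ)) e =
      ∑ r, (((Finsupp.toMultiset e).toList.get r).1 : ℕ) := fun e => by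
    have h1 : ∀ l : List (ℕ+ × I), ∑ r, ((l.get r).1 : ℕ) = (l.map fun s => (s.1 : ℕ)).sum :=
      fun l => by
        rw [← List.sum_ofFn]; congr 1
        conv_rhs => rw [← List.ofFn_get l, List.map_ofFn]
        rfl
    rw [h1, ← Multiset.sum_coe, ← Multiset.map_coe, Multiset.coe_toList]
    induction e using Finsupp.induction_linear with
    | zero => simp
    | add e f he hf => simp only [map_add, Multiset.map_add, Multiset.sum_add, he, hf]
    | single s n => simp [Finsupp.weight_apply, Multiset.map_nsmul, Multiset.sum_nsmul]
  rw [form, Module.Basis.constr_basis, Module.Basis.constr_basis, seqPairing]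
  split_ifs with hl
  · refine Finset.sum_eq_zero fun σ _ => ?_
    by_contra h0
    apply hef
    rw [hw, hw, ← Equiv.sum_comp (σ.trans (finCongr hl))]
    refine Finset.sum_congr rfl fun r _ => ?_
    have h1 := Finset.prod_ne_zero_iff.1 h0 r (Finset.mem_univ r)
    rw [genPairing] at h1
    exact congrArg _ (ite_ne_right_iff.1 h1).1
  · rfl

theorem form_eq_zero_of_mem_symDegree {m n : ℕ} (hmn : m ≠ n) {x a : SymPow I}
    (hx : x ∈ symDegree I m) (ha : a ∈ symDegree I n) : form A x a = 0 := by
  rw [symDegree_eq_span] at hx ha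
  induction hx, ha using Submodule.span_induction₂ with
  | mem_mem x y hx hy =>
    obtain ⟨e, rfl, rfl⟩ := hx
    obtain ⟨f, rfl, rfl⟩ := hy
    exact form_symBasis_eq_zero A e f hmn
  | zero_left => simp
  | zero_right => simp
  | add_left x y z _ _ _ h1 h2 => simp [h1, h2]
  | add_right x y z _ _ _ h1 h2 => simp [h1, h2]
  | smul_left c x y _ _ h1 => simp [h1]
  | smul_right c x y _ _ h1 => simp [h1]

instance finiteDimensional_symDegree [Finite I] (n : ℕ) : FiniteDimensional K (symDegree I n) := by
  classical
  have := Fintype.ofFinite I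
  rw [symDegree_eq_span]
  refine FiniteDimensional.span_of_finite K (Set.Finite.image _ ?_)
  -- Exponents and indices of the occurring power sums are at most `n`. The index bound is `n + 1`
  -- because it must be positive also when `n = 0`.
  refine Set.Finite.subset (Finset.finite_toSet (Finset.finsupp
    ((Finset.Icc 1 n.succPNat) ×ˢ (Finset.univ : Finset I)) fun _ => Finset.range (n + 1)))
    fun e he => ?_
  have h1 : ∀ s, e s * (s.1 : ℕ) ≤ n := fun s => by
    rw [← (he : _ = n), Finsupp.weight_apply]
    by_cases hs : e s = 0
    · simp [hs]
    · exact Finset.single_le_sum (f := fun s => e s • (s.1 : ℕ)) (fun _ _ => Nat.zero_le _)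
        (Finsupp.mem_support_iff.2 hs)
  rw [Finset.mem_coe, Finset.mem_finsupp_iff]
  refine ⟨fun s hs => ?_, fun s _ => ?_⟩
  · have h2 := h1 s
    have h3 : 0 < e s := Nat.pos_of_ne_zero (Finsupp.mem_support_iff.1 hs)
    simp only [Finset.mem_product, Finset.mem_Icc, one_le, true_and, Finset.mem_univ, and_true]
    rw [← PNat.coe_le_coe, Nat.succPNat_coe]
    nlinarith
  · have := h1 s
    have := s.1.pos
    rw [Finset.mem_range]
    nlinarith

theorem IsSimplyLaced.isDualPair [Fintype I] {A : Matrix I I ℤ} (hA : IsSimplyLaced A) :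
    IsDualPair (symDegree I) (symDegree I) (form A) where
  isHopfPairing := isHopfPairing_form A
  orthogonal _ _ hmn _ hx _ ha := form_eq_zero_of_mem_symDegree A hmn hx ha
  perfect n := by
    -- Orthogonality of degrees extends the vanishing to all of `Sym^{⊗ I}`; finite dimension then
    -- makes injectivity on both sides sufficient.
    have key : ∀ x ∈ symDegree I n, (∀ a ∈ symDegree I n, form A x a = 0) → x = 0 := by
      intro x hx h
      refine hA.form_nondegenerate fun y => ?_
      have : form A x = 0 := (symBasis I).ext fun e => by
        by_cases hn : Finsupp.weight (fun s : ℕ+ × I => (s.1 : ℕ)) e = n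
        · exact h _ (hn ▸ symBasis_mem_symDegree e)
        · exact form_eq_zero_of_mem_symDegree A (Ne.symm hn) hx (symBasis_mem_symDegree e)
      rw [this, LinearMap.zero_apply]
    refine LinearMap.IsPerfPair.of_injective ?_ ?_
    · refine (injective_iff_map_eq_zero _).2 fun x hx => Subtype.ext (key x x.2 fun a ha => ?_)
      exact LinearMap.congr_fun hx ⟨a, ha⟩
    · refine (injective_iff_map_eq_zero _).2 fun x hx => Subtype.ext (key x x.2 fun a ha => ?_)
      rw [form_comm hA.symm]
      exact LinearMap.congr_fun hx ⟨a, ha⟩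

end Degree

/-! ### Reduction of the Cartan types to simply laced matrices -/

section Cartan

variable {I : Type*} [Fintype I] {A : Matrix I I ℤ}

/-- Positivity at this vector bounds `A i j` below: strictly by `-2` in finite type, weakly in
affine type. -/
theorem quadratic_pair [DecidableEq I] (hA : IsSymmetricGCM A) (i j : I) :
    star (Pi.single i 1 + Pi.single j 1 : I → ℝ) ⬝ᵥ
      (A.map (fun z : ℤ => (z : ℝ))).mulVec (Pi.single i 1 + Pi.single j 1) = 4 + 2 * A i j := by
  have h1 := hA.symm.apply i j
  simp [Matrix.mulVec_add, add_dotProduct, hA.diag, h1]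
  ring

theorem IsFiniteADE.isSimplyLaced (hA : IsFiniteADE A) : IsSimplyLaced A where
  symm := hA.1.symm
  diag := hA.1.diag
  offDiag i j hij := by
    classical
    have h1 := hA.2.dotProduct_mulVec_pos (x := (Pi.single i 1 + Pi.single j 1 : I → ℝ)) (fun h => by
      have := congrFun h i
      simp [hij] at this)
    rw [quadratic_pair hA.1] at h1
    have h2 : 0 < 4 + 2 * A i j := by exact_mod_cast h1
    have := hA.1.offDiag i j hij
    omega

/-- An entry `-2` makes `e_i + e_j` isotropic, hence a null vector of `A`. Indecomposability then
leaves no vertex besides `i` and `j`, which is the excluded type. -/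
theorem IsAffineADE.isSimplyLaced (hA : IsAffineADE A) (hA11 : ¬ IsTypeA11 A) :
    IsSimplyLaced A where
  symm := hA.1.symm
  diag := hA.1.diag
  offDiag i j hij := by
    classical
    obtain ⟨hG, hI, hP, -⟩ := hA
    have h1 := hP.dotProduct_mulVec_nonneg (Pi.single i 1 + Pi.single j 1 : I → ℝ)
    have h0 := quadratic_pair hG i j
    rw [h0] at h1
    have h2 : 0 ≤ 4 + 2 * A i j := by exact_mod_cast h1
    have h3 := hG.offDiag i j hij
    by_contra hcon
    have h4 : A i j = -2 := by omega
    apply hA11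
    have h5 : ∀ k, A k i + A k j = 0 := fun k => by
      have := (hP.dotProduct_mulVec_zero_iff _).1 (h0.trans (by rw [h4]; norm_num))
      have := congrFun this k
      simp [Matrix.mulVec_add] at this
      exact_mod_cast this
    -- Outside `{i, j}` the entries `A b i` and `A b j` are nonpositive with sum zero, so `{i, j}`
    -- would split off.
    have h6 : ∀ k, k = i ∨ k = j := by
      by_contra! hk
      obtain ⟨k, hk⟩ := hk
      obtain ⟨a, ha, b, hb, hab⟩ := hI {i, j} ⟨i, by simp⟩ ⟨k, by simpa using hk⟩
      have hb' : b ≠ i ∧ b ≠ j := by simpa using hb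
      have h7 := h5 b
      have h8 := hG.offDiag b i hb'.1
      have h9 := hG.offDiag b j hb'.2
      rw [← hG.symm.apply] at hab
      rcases ha with rfl | rfl <;> omega
    let f : I → Fin 2 := fun k => if k = i then 0 else 1
    have hf : Function.Bijective f := by
      constructor
      · intro a b hab
        rcases h6 a with rfl | rfl <;> rcases h6 b with rfl | rfl <;>
          simp_all [f, eq_comm]
      · intro b
        fin_cases b
        · exact ⟨i, by simp [f]⟩
        · exact ⟨j, by simp [f, hij.symm]⟩
    let e := Equiv.ofBijective f hf
    have e0 : e.symm 0 = i := by rw [Equiv.symm_apply_eq]; simp [e, f]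
    have e1 : e.symm 1 = j := by rw [Equiv.symm_apply_eq]; simp [e, f, hij.symm]
    refine ⟨e, ?_⟩
    ext a b
    have h10 := hG.symm.apply i j
    fin_cases a <;> fin_cases b <;> simp [e0, e1, hG.diag, h4, h10]

end Cartan

/-! ### Newton's recursion and the coproduct of the complete functions -/

section Newton

variable {I : Type*}

theorem count_cons_factor (a : ℕ) (s : Multiset ℕ) :
    ∏ k ∈ (a ::ₘ s).toFinset, qint k ^ (a ::ₘ s).count k * (((a ::ₘ s).count k).factorial : K) =
      (qint a * (s.count a + 1 : K)) *
        ∏ k ∈ s.toFinset, qint k ^ s.count k * ((s.count k).factorial : K) := by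
  classical
  have h1 : ∏ k ∈ s.toFinset, qint k ^ s.count k * ((s.count k).factorial : K) =
      ∏ k ∈ insert a s.toFinset, qint k ^ s.count k * ((s.count k).factorial : K) := by
    refine Finset.prod_subset (Finset.subset_insert _ _) fun k _ hk => ?_
    rw [Multiset.count_eq_zero_of_notMem (by simpa using hk)]
    simp
  rw [h1, Multiset.toFinset_cons, ← Finset.mul_prod_erase _ _ (Finset.mem_insert_self _ _),
    ← Finset.mul_prod_erase _ _ (Finset.mem_insert_self a s.toFinset), ← mul_assoc]
  congr 1
  · rw [Multiset.count_cons_self, Nat.factorial_succ, pow_succ]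
    push_cast
    ring
  · refine Finset.prod_congr rfl fun k hk => ?_
    rw [Multiset.count_cons_of_ne (Finset.ne_of_mem_erase hk)]

/-- The coefficient of `p_k` in Newton's recursion for the quantized complete symmetric
functions. -/
def newtonCoeff (k : ℕ) : K := k / qint k

@[simp]
theorem newtonCoeff_zero : newtonCoeff 0 = 0 := by simp [newtonCoeff]

theorem newtonCoeff_ne_zero {k : ℕ} (hk : k ≠ 0) : newtonCoeff k ≠ 0 :=
  div_ne_zero (by exact_mod_cast hk) (qint_ne_zero hk)

theorem h_zero (i : I) : h 0 i = 1 := by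
  simp [h, Z]

theorem p_coe (n : ℕ+) (i : I) : p (n : ℕ) i = SymPow.X (n, i) := by
  rw [p, dif_pos n.pos]; rfl

/-- The weight kills partitions without the part `a`. On the others, removing one part `a` is a
bijection onto partitions of `n - a` that divides `Z` by `[a]` times the multiplicity, which the
weight cancels. -/
theorem sum_partition_with_part (n a : ℕ) (ha1 : 1 ≤ a) (ha : a ≤ n) (i : I) :
    ∑ l : n.Partition, ((a * l.parts.count a : ℕ) : K) •
        ((Z l)⁻¹ • (l.parts.map fun k => p k i).prod) =
      newtonCoeff a • (p a i * h (n - a) i) := by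
  classical
  rw [← Finset.sum_filter_of_ne (p := fun l : n.Partition => a ∈ l.parts),
    Finset.sum_subtype _ (p := fun l : n.Partition => a ∈ l.parts) (by simp),
    ← Equiv.sum_comp (Nat.Partition.partitionWithPartEquiv ha1 ha).symm, h, Finset.mul_sum,
    Finset.smul_sum]
  · refine Finset.sum_congr rfl fun l _ => ?_
    have hl : (((Nat.Partition.partitionWithPartEquiv ha1 ha).symm l).1 : n.Partition).parts =
        a ::ₘ l.parts := Nat.Partition.partitionWithPartEquiv_symm_apply_parts ha1 ha l
    have hZ : Z (((Nat.Partition.partitionWithPartEquiv ha1 ha).symm l).1 : n.Partition) =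
        (qint a * (l.parts.count a + 1 : K)) * Z l := by
      rw [Z, hl, count_cons_factor, Z]
    rw [hZ, hl, Multiset.count_cons_self, Multiset.map_cons, Multiset.prod_cons, smul_smul,
      mul_smul_comm, smul_smul, newtonCoeff, mul_inv, mul_inv]
    congr 1
    have : (l.parts.count a + 1 : K) ≠ 0 := by
      exact_mod_cast Nat.succ_ne_zero (l.parts.count a)
    push_cast
    field_simp
  · intro l _ hl
    by_contra hal
    exact hl (by rw [Multiset.count_eq_zero_of_notMem hal]; simp)

/-- Write `n` as the sum of `a · m_a(λ)` over `a`. The convention `p 0 i = 1` is harmless since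
`newtonCoeff 0 = 0`. -/
theorem h_newton (n : ℕ) (i : I) : (n : K) • h n i =
    ∑ x ∈ Finset.HasAntidiagonal.antidiagonal n, newtonCoeff x.1 • (p x.1 i * h x.2 i) := by
  classical
  have h1 : ∀ l : n.Partition, (n : K) • ((Z l)⁻¹ • (l.parts.map fun k => p k i).prod) =
      ∑ a ∈ Finset.range (n + 1), ((a * l.parts.count a : ℕ) : K) •
        ((Z l)⁻¹ • (l.parts.map fun k => p k i).prod) := fun l => by
    rw [← Finset.sum_smul, ← Nat.cast_sum]
    congr 2
    conv_lhs => rw [← l.parts_sum, Finset.sum_multiset_count]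
    refine Finset.sum_subset_zero_on_sdiff (fun a ha => ?_) (fun a ha => ?_) fun a _ => ?_
    · exact Finset.mem_range_succ_iff.2 (l.le_of_mem_parts (by simpa using ha))
    · rw [Multiset.count_eq_zero_of_notMem (by simpa using (Finset.mem_sdiff.1 ha).2), mul_zero]
    · rw [smul_eq_mul, mul_comm]
  rw [h, Finset.smul_sum, Finset.sum_congr rfl fun l _ => h1 l, Finset.sum_comm,
    Finset.Nat.sum_antidiagonal_eq_sum_range_succ_mk]
  refine Finset.sum_congr rfl fun a ha => ?_
  rcases Nat.eq_zero_or_pos a with rfl | ha1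
  · simp
  · exact sum_partition_with_part n a ha1 (Finset.mem_range_succ_iff.1 ha) i

/-- A sequence satisfying a recursion of Newton type is determined by its initial value. -/
theorem newton_unique {B : Type*} [Ring B] [Algebra K B] {w F G : ℕ → B} (hw : w 0 = 0)
    (h0 : F 0 = G 0)
    (hF : ∀ n : ℕ, (n : K) • F n = ∑ x ∈ Finset.HasAntidiagonal.antidiagonal n, w x.1 * F x.2)
    (hG : ∀ n : ℕ, (n : K) • G n = ∑ x ∈ Finset.HasAntidiagonal.antidiagonal n, w x.1 * G x.2)
    (n : ℕ) :
    F n = G n := by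
  induction n using Nat.strong_induction_on with
  | _ n ih =>
    rcases Nat.eq_zero_or_pos n with rfl | hn
    · exact h0
    · have hn0 : (n : K) ≠ 0 := by exact_mod_cast hn.ne'
      refine smul_right_injective B hn0 ?_
      change (n : K) • F n = (n : K) • G n
      rw [hF, hG]
      refine Finset.sum_congr rfl fun x hx => ?_
      have hx := Finset.HasAntidiagonal.mem_antidiagonal.1 hx
      rcases Nat.eq_zero_or_pos x.1 with h1 | h1
      · rw [h1, hw, zero_mul, zero_mul]
      · rw [ih x.2 (by omega)]

theorem coeff_X_mul_derivative {B : Type*} [CommRing B] [Algebra K B] (F : PowerSeries B) (n : ℕ) :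
    PowerSeries.coeff n (PowerSeries.X * PowerSeries.derivative B F) =
      (n : K) • PowerSeries.coeff n F := by
  rw [Algebra.smul_def, map_natCast]
  cases n with
  | zero => simp
  | succ n =>
    rw [PowerSeries.coeff_succ_X_mul, PowerSeries.coeff_derivative]
    push_cast; ring

/-- Sequences satisfying recursions of Newton type may be convolved. -/
theorem newton_convolution {B : Type*} [CommRing B] [Algebra K B] {v w F G : ℕ → B}
    (hF : ∀ n : ℕ, (n : K) • F n = ∑ x ∈ Finset.HasAntidiagonal.antidiagonal n, v x.1 * F x.2)
    (hG : ∀ n : ℕ, (n : K) • G n = ∑ x ∈ Finset.HasAntidiagonal.antidiagonal n, w x.1 * G x.2)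
    (n : ℕ) :
    (n : K) • ∑ x ∈ Finset.HasAntidiagonal.antidiagonal n, F x.1 * G x.2 =
      ∑ x ∈ Finset.HasAntidiagonal.antidiagonal n, (v x.1 + w x.1) *
        ∑ y ∈ Finset.HasAntidiagonal.antidiagonal x.2, F y.1 * G y.2 := by
  -- The recursion says `z E' = u E` for generating series, so the product rule adds the weights.
  have key : ∀ (u E : ℕ → B),
      (∀ n : ℕ, (n : K) • E n = ∑ x ∈ Finset.HasAntidiagonal.antidiagonal n, u x.1 * E x.2) →
      PowerSeries.X * PowerSeries.derivative B (PowerSeries.mk E) =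
        PowerSeries.mk u * PowerSeries.mk E := by
    intro u E hE
    ext n
    rw [coeff_X_mul_derivative, PowerSeries.coeff_mk, hE, PowerSeries.coeff_mul]
    simp only [PowerSeries.coeff_mk]
  have h1 := key v F hF
  have h2 := key w G hG
  have h3 : PowerSeries.X * PowerSeries.derivative B (PowerSeries.mk F * PowerSeries.mk G) =
      (PowerSeries.mk v + PowerSeries.mk w) * (PowerSeries.mk F * PowerSeries.mk G) := by
    rw [Derivation.leibniz, smul_eq_mul, smul_eq_mul]
    linear_combination PowerSeries.mk F * h2 + PowerSeries.mk G * h1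
  have h4 := congrArg (PowerSeries.coeff n) h3
  rw [coeff_X_mul_derivative, PowerSeries.coeff_mul, PowerSeries.coeff_mul] at h4
  simpa only [PowerSeries.coeff_mul, map_add, PowerSeries.coeff_mk] using h4

/-- Both sides solve the recursion with weights `newtonCoeff k` times `p_k ⊗ 1 + 1 ⊗ p_k`. -/
theorem symComul_h (n : ℕ) (i : I) :
    symComul I (h n i) = ∑ x ∈ Finset.HasAntidiagonal.antidiagonal n, h x.1 i ⊗ₜ[K] h x.2 i := by
  let v : ℕ → SymPow I ⊗[K] SymPow I := fun k => (newtonCoeff k • p k i) ⊗ₜ 1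
  let w : ℕ → SymPow I ⊗[K] SymPow I := fun k => 1 ⊗ₜ (newtonCoeff k • p k i)
  have h1 : symComul I (h n i) = ∑ x ∈ Finset.HasAntidiagonal.antidiagonal n,
      (h x.1 i ⊗ₜ[K] (1 : SymPow I)) * ((1 : SymPow I) ⊗ₜ[K] h x.2 i) := by
    refine newton_unique (w := fun k => v k + w k) (F := fun n => symComul I (h n i))
      (G := fun n => ∑ x ∈ Finset.HasAntidiagonal.antidiagonal n,
        (h x.1 i ⊗ₜ[K] (1 : SymPow I)) * ((1 : SymPow I) ⊗ₜ[K] h x.2 i)) ?_ ?_ ?_ ?_ n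
    · simp [v, w]
    · simp [h_zero, Algebra.TensorProduct.one_def]
    · intro n
      rw [← map_smul, h_newton, map_sum]
      refine Finset.sum_congr rfl fun x _ => ?_
      rcases Nat.eq_zero_or_pos x.1 with h0 | h0
      · simp [h0, v, w]
      · rw [map_smul, map_mul, p, dif_pos h0, symComul_X, ← smul_mul_assoc]
        simp [v, w, p, dif_pos h0, TensorProduct.smul_tmul']
    · refine newton_convolution (v := v) (w := w) (F := fun n => h n i ⊗ₜ[K] (1 : SymPow I))
        (G := fun n => (1 : SymPow I) ⊗ₜ[K] h n i) ?_ ?_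
      · intro n
        rw [TensorProduct.smul_tmul', h_newton, TensorProduct.sum_tmul]
        simp [v]
      · intro n
        rw [← TensorProduct.tmul_smul, h_newton, TensorProduct.tmul_sum]
        simp [w]
  simpa using h1

theorem p_mem_symDegree {n : ℕ} (hn : n ≠ 0) (i : I) : p n i ∈ symDegree I n := by
  rw [p, dif_pos (Nat.pos_of_ne_zero hn)]
  exact MvPolynomial.isWeightedHomogeneous_X K (fun s : ℕ+ × I => (s.1 : ℕ))
    (⟨n, Nat.pos_of_ne_zero hn⟩, i)

theorem mul_mem_symDegree {m n : ℕ} {a b : SymPow I} (ha : a ∈ symDegree I m)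
    (hb : b ∈ symDegree I n) : a * b ∈ symDegree I (m + n) :=
  MvPolynomial.IsWeightedHomogeneous.mul (R := K) (w := fun s : ℕ+ × I => (s.1 : ℕ)) ha hb

theorem h_mem_symDegree (n : ℕ) (i : I) : h n i ∈ symDegree I n := by
  induction n using Nat.strong_induction_on with
  | _ n ih =>
    rcases Nat.eq_zero_or_pos n with rfl | hn
    · rw [h_zero]
      exact MvPolynomial.isWeightedHomogeneous_one K (fun s : ℕ+ × I => (s.1 : ℕ))
    · have hn0 : (n : K) ≠ 0 := by exact_mod_cast hn.ne'
      rw [← Submodule.smul_mem_iff _ hn0, h_newton]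
      refine Submodule.sum_mem _ fun x hx => ?_
      have hx := Finset.HasAntidiagonal.mem_antidiagonal.1 hx
      rcases Nat.eq_zero_or_pos x.1 with h1 | h1
      · simp [h1]
      · rw [← hx]
        exact Submodule.smul_mem _ _ (mul_mem_symDegree (p_mem_symDegree h1.ne' i)
          (ih x.2 (by omega)))

end Newton

/-! ### Pairings of the complete symmetric functions -/

section CompletePairing

variable {I : Type*} {A : Matrix I I ℤ}

/-- In the coproduct of `h m j` only the term with right factor of degree `k` pairs with `x`. -/
theorem fock_h {k : ℕ} {x : SymPow I} (hx : x ∈ symDegree I k) (m : ℕ) (j : I) :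
    fock A x (h m j) = if k ≤ m then form A x (h k j) • h (m - k) j else 0 := by
  have h1 : fock A x (h m j) =
      ∑ y ∈ Finset.HasAntidiagonal.antidiagonal m, form A x (h y.2 j) • h y.1 j := by
    rw [← leftRegular_form]
    change TensorProduct.rid K (SymPow I) ((form A x).lTensor (SymPow I) (symComul I (h m j))) = _
    rw [symComul_h]
    simp
  rw [h1]
  split_ifs with hk
  · rw [Finset.sum_eq_single (m - k, k)]
    · intro y hy hne
      have hy := Finset.HasAntidiagonal.mem_antidiagonal.1 hy
      rw [form_eq_zero_of_mem_symDegree A (m := k) (n := y.2) _ hx (h_mem_symDegree _ _), zero_smul]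
      intro h2
      exact hne (Prod.ext (by simp only; omega) h2.symm)
    · intro hn
      exact absurd (Finset.HasAntidiagonal.mem_antidiagonal.2 (Nat.sub_add_cancel hk)) hn
  · refine Finset.sum_eq_zero fun y hy => ?_
    have hy := Finset.HasAntidiagonal.mem_antidiagonal.1 hy
    rw [form_eq_zero_of_mem_symDegree A (m := k) (n := y.2) (by omega) hx (h_mem_symDegree _ _),
      zero_smul]

theorem form_p_h (hA : A.IsSymm) {n : ℕ} (hn : n ≠ 0) (i j : I) :
    newtonCoeff n * form A (p n i) (h n j) = qint (n * A i j) / qint n := by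
  have hn0 : (n : K) ≠ 0 := by exact_mod_cast hn
  have hq := qint_ne_zero hn
  have h1 : (n : K) * form A (p n i) (h n j) =
      newtonCoeff n * (qint (n * A j i) * (qint n / n)) := by
    rw [← smul_eq_mul, ← map_smul, h_newton, map_sum, Finset.sum_eq_single (n, 0)]
    · have h0 : 0 < n := Nat.pos_of_ne_zero hn
      simp only [map_smul, p, dif_pos h0, form_X_mul A hA, annihilation_X, h_zero, form_one_right,
        AlgHom.commutes]
      simp only [genPairing]
      rw [if_pos (by rfl)]
      simp
    · intro y hy hne
      have hy := Finset.HasAntidiagonal.mem_antidiagonal.1 hy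
      rcases Nat.eq_zero_or_pos y.1 with h0 | h0
      · simp [h0]
      · rw [map_smul, p, p, dif_pos h0, dif_pos (Nat.pos_of_ne_zero hn), form_X_mul A hA,
          annihilation_X, genPairing, if_neg]
        · simp
        · intro h2
          have h3 : y.1 = n := congrArg PNat.val h2
          exact hne (Prod.ext h3 (by simp only; omega))
    · intro h2
      exact absurd (Finset.HasAntidiagonal.mem_antidiagonal.2 (add_zero n)) h2
  rw [newtonCoeff] at h1 ⊢
  rw [hA.apply] at h1
  field_simp at h1 ⊢
  linear_combination h1

/-- By `newton_unique` this recursion determines the pairings; the three possible entries of `A` are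
solved separately. -/
theorem form_h_h_newton (hA : A.IsSymm) (i j : I) (n : ℕ) :
    (n : K) • form A (h n i) (h n j) = ∑ x ∈ Finset.HasAntidiagonal.antidiagonal n,
      qint (x.1 * A i j) / qint x.1 * form A (h x.2 i) (h x.2 j) := by
  rw [← LinearMap.smul_apply, ← map_smul, h_newton, map_sum, LinearMap.sum_apply]
  refine Finset.sum_congr rfl fun x hx => ?_
  have hx := Finset.HasAntidiagonal.mem_antidiagonal.1 hx
  rcases Nat.eq_zero_or_pos x.1 with h0 | h0
  · simp [h0, qint_zero]
  · rw [← form_p_h hA h0.ne', map_smul, LinearMap.smul_apply, mul_comm (p x.1 i), form_apply,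
      map_mul, Module.End.mul_apply, fock_h (p_mem_symDegree h0.ne' i), if_pos (by omega), map_smul,
      map_smul, ← form_apply, show n - x.1 = x.2 by omega, smul_eq_mul, smul_eq_mul, mul_assoc]

theorem form_h_zero (i j : I) : form A (h 0 i) (h 0 j) = 1 := by
  rw [h_zero, h_zero, form_one_right, map_one]

theorem qint_one : qint 1 = 1 := by
  have := qint_natCast 1
  rw [pow_one, pow_one, div_self q_inv_sub_q_ne_zero] at this
  exact_mod_cast this

theorem form_h_h_distant (hA : A.IsSymm) {i j : I} (hij : A i j = 0) (n : ℕ) :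
    form A (h n i) (h n j) = if n = 0 then 1 else 0 := by
  refine newton_unique (w := fun k => qint (k * A i j) / qint k)
    (F := fun n => form A (h n i) (h n j))
    (G := fun n => if n = 0 then 1 else 0) (by simp [qint_zero]) ?_ (form_h_h_newton hA i j) ?_ n
  · simp [form_h_zero]
  · intro n
    simp only [hij, mul_zero, qint_zero, zero_div, zero_mul, Finset.sum_const_zero]
    split_ifs with h0 <;> simp [h0]

/-- The sign convention for `[-k]` makes the weights `(-1)^(k+1)`, those of `z d/dz log (1 + z)`.
For `n ≥ 2` the two surviving terms cancel. -/
theorem form_h_h_adjacent (hA : A.IsSymm) {i j : I} (hij : A i j = -1) (n : ℕ) :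
    form A (h n i) (h n j) = if n ≤ 1 then 1 else 0 := by
  refine newton_unique (w := fun k => qint (k * A i j) / qint k)
    (F := fun n => form A (h n i) (h n j))
    (G := fun n => if n ≤ 1 then 1 else 0) (by simp [qint_zero]) ?_ (form_h_h_newton hA i j) ?_ n
  · simp [form_h_zero]
  · intro n
    have hw : ∀ k : ℕ, k ≠ 0 → qint (k * A i j) / qint k = (-1) ^ (k + 1) := fun k hk => by
      rw [hij, mul_neg, mul_one, qint_neg, mul_div_cancel_right₀ _ (qint_ne_zero hk)]
    rcases n with - | - | n
    · simp [qint_zero]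
    · rw [zero_add, ← zero_add 1, Finset.Nat.sum_antidiagonal_succ', hw _ (by omega)]
      simp [qint_zero]
    · rw [Finset.Nat.sum_antidiagonal_succ', Finset.Nat.sum_antidiagonal_succ',
        hw _ (by omega), hw _ (by omega), Finset.sum_eq_zero fun x _ => by simp]
      simp [pow_succ]

/-- For `k > 0` the weights are `q⁻ᵏ + qᵏ`, the coefficients of `z d/dz log` of `1 / ((1 - q z)(1 -
q⁻¹ z)) = ∑ [n+1] zⁿ`. -/
theorem sum_qint_mul_qint_succ {i : I} (hi : A i i = 2) (n : ℕ) :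
    (n : K) • qint (n + 1) = ∑ x ∈ Finset.HasAntidiagonal.antidiagonal n,
      qint (x.1 * A i i) / qint x.1 * qint (x.2 + 1) := by
  -- At `k = 0` the weight is `0 / 0 = 0`, while `q⁻ᵏ + qᵏ = 2`.
  have hw : ∀ k : ℕ, qint (k * A i i) / qint k = q⁻¹ ^ k + q ^ k - if k = 0 then 2 else 0 := by
    intro k
    rcases Nat.eq_zero_or_pos k with rfl | hk
    · norm_num [qint_zero]
    · rw [hi, qint_mul_two, mul_div_cancel_left₀ _ (qint_ne_zero hk.ne'), if_neg hk.ne', sub_zero]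
  have hs : ∀ k : ℕ, qint (k + 1) = (q⁻¹ ^ (k + 1) - q ^ (k + 1)) / (q⁻¹ - q) := fun k => by
    exact_mod_cast qint_natCast (k + 1)
  have h1 : ∑ x ∈ Finset.HasAntidiagonal.antidiagonal n, (if x.1 = 0 then 2 else 0) *
      qint (x.2 + 1) = 2 * qint (n + 1) := by
    rw [Finset.sum_eq_single (0, n)]
    · simp
    · intro x hx hne
      have hx := Finset.HasAntidiagonal.mem_antidiagonal.1 hx
      rw [if_neg (fun h0 => hne (Prod.ext h0 (by simp only; omega))), zero_mul]
    · simp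
  have h2 : ∑ x ∈ Finset.HasAntidiagonal.antidiagonal n, (q⁻¹ ^ x.1 + q ^ x.1) * qint (x.2 + 1) =
      (n + 2) * qint (n + 1) := by
    have hg := geom_sum₂_mul q⁻¹ q (n + 1)
    simp only [add_tsub_cancel_right] at hg
    obtain ⟨c, hc⟩ : ∃ c, c = q⁻¹ ^ (n + 1) - q ^ (n + 1) := ⟨_, rfl⟩
    -- Each of the `n + 1` terms contributes `c`; the cross terms form a geometric sum that
    -- contributes one more.
    have h3 : ∀ x ∈ Finset.HasAntidiagonal.antidiagonal n,
        (q⁻¹ ^ x.1 + q ^ x.1) * qint (x.2 + 1) = (c +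
          ((q⁻¹ ^ x.2 * q ^ x.1) * q⁻¹ - (q⁻¹ ^ x.1 * q ^ x.2) * q)) / (q⁻¹ - q) := by
      intro x hx
      rw [hs, hc, ← Finset.HasAntidiagonal.mem_antidiagonal.1 hx]
      ring
    have h4 : ∑ x ∈ Finset.HasAntidiagonal.antidiagonal n, q⁻¹ ^ x.2 * q ^ x.1 =
        ∑ x ∈ Finset.HasAntidiagonal.antidiagonal n, q⁻¹ ^ x.1 * q ^ x.2 :=
      Finset.Nat.sum_antidiagonal_swap (f := fun x => q⁻¹ ^ x.1 * q ^ x.2)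
    rw [Finset.sum_congr rfl h3, ← Finset.sum_div, Finset.sum_add_distrib, Finset.sum_sub_distrib,
      ← Finset.sum_mul, ← Finset.sum_mul, h4, ← mul_sub,
      Finset.Nat.sum_antidiagonal_eq_sum_range_succ_mk (fun x => q⁻¹ ^ x.1 * q ^ x.2), hg, hs]
    simp only [← hc, Finset.sum_const, Finset.Nat.card_antidiagonal, nsmul_eq_mul]
    push_cast
    ring
  simp only [hw, sub_mul, Finset.sum_sub_distrib, h1, h2, smul_eq_mul]
  ring

theorem form_h_h_self (hA : A.IsSymm) {i : I} (hi : A i i = 2) (n : ℕ) :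
    form A (h n i) (h n i) = qint (n + 1) := by
  refine newton_unique (w := fun k => qint (k * A i i) / qint k)
    (F := fun n => form A (h n i) (h n i)) (G := fun n => qint (n + 1))
    (by simp [qint_zero]) ?_ (form_h_h_newton hA i i) ?_ n
  · simp [form_h_zero, qint_one]
  · exact sum_qint_mul_qint_succ hi

end CompletePairing

/-! ### Normal ordering and the presentation by power sums -/

section Heisenberg

variable {I : Type*} (A : Matrix I I ℤ)

theorem QuantumToroidal.gen_comm (s t : ℕ+ × I) :
    gen A s.1 s.2 * gen A t.1 t.2 = gen A t.1 t.2 * gen A s.1 s.2 := by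
  simp only [gen, ← map_mul]
  exact RingQuot.mkAlgHom_rel K (PRel.p_comm _ _ _ _)

theorem QuantumToroidal.gen'_comm (s t : ℕ+ × I) :
    gen' A s.1 s.2 * gen' A t.1 t.2 = gen' A t.1 t.2 * gen' A s.1 s.2 := by
  simp only [gen', ← map_mul]
  exact RingQuot.mkAlgHom_rel K (PRel.p_comm' _ _ _ _)

theorem QuantumToroidal.gen'_mul_gen (s t : ℕ+ × I) :
    gen' A s.1 s.2 * gen A t.1 t.2 =
      gen A t.1 t.2 * gen' A s.1 s.2 + algebraMap K _ (genPairing A s t) := by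
  have h1 := RingQuot.mkAlgHom_rel K (PRel.p_mixed (A := A) s.1 t.1 s.2 t.2)
  rw [map_mul, map_add, map_mul, AlgHom.commutes] at h1
  rw [gen, gen', h1, genPairing]
  congr 2
  split_ifs with h2
  · rw [h2]
  · rfl

/-- The embedding of `H⁺`. -/
def QuantumToroidal.plus : SymPow I →ₐ[K] QuantumToroidal A :=
  (SymPow.exists_algHom_of_commute _ (QuantumToroidal.gen_comm A)).choose

/-- The embedding of `H⁻`. -/
def QuantumToroidal.minus : SymPow I →ₐ[K] QuantumToroidal A :=
  (SymPow.exists_algHom_of_commute _ (QuantumToroidal.gen'_comm A)).choose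

@[simp]
theorem QuantumToroidal.plus_X (s : ℕ+ × I) : plus A (SymPow.X s) = gen A s.1 s.2 :=
  (SymPow.exists_algHom_of_commute _ (QuantumToroidal.gen_comm A)).choose_spec s

@[simp]
theorem QuantumToroidal.minus_X (s : ℕ+ × I) : minus A (SymPow.X s) = gen' A s.1 s.2 :=
  (SymPow.exists_algHom_of_commute _ (QuantumToroidal.gen'_comm A)).choose_spec s

theorem QuantumToroidal.gen'_mul_plus (s : ℕ+ × I) (b : SymPow I) :
    gen' A s.1 s.2 * plus A b = plus A b * gen' A s.1 s.2 + plus A (annihilation A s b) := by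
  induction b using SymPow.induction with
  | scalar c => simp [← Algebra.commutes]
  | add a b ha hb => simp only [map_add, mul_add, add_mul, ha, hb]; abel
  | X_mul t b ih =>
    rw [map_mul, plus_X, ← mul_assoc, gen'_mul_gen, add_mul, mul_assoc, ih, Derivation.leibniz,
      annihilation_X, map_add, smul_eq_mul, smul_eq_mul, map_mul, map_mul, plus_X,
      AlgHom.commutes, mul_add, ← Algebra.commutes, mul_assoc, add_assoc]

/-- The normal ordering map `a # x ↦ a x`. -/
def QuantumToroidal.ordered : SymPow I ⊗[K] SymPow I →ₗ[K] QuantumToroidal A :=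
  LinearMap.mul' K (QuantumToroidal A) ∘ₗ
    TensorProduct.map (plus A).toLinearMap (minus A).toLinearMap

@[simp]
theorem QuantumToroidal.ordered_tmul (a x : SymPow I) :
    ordered A (a ⊗ₜ x) = plus A a * minus A x := rfl

theorem exchange_form (x b : SymPow I) : exchange (form A) x b =
    TensorProduct.map ((fock A).toLinearMap.flip b) LinearMap.id (symComul I x) := by
  have : (leftRegular (form A)).flip b = (fock A).toLinearMap.flip b :=
    LinearMap.ext fun x => leftRegular_form A x b
  rw [exchange, this]
  rfl

/-- Moving one `p'_s` past `H⁺` either differentiates or passes through, which matches the two terms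
of its primitive coproduct. -/
theorem QuantumToroidal.minus_mul_plus (x b : SymPow I) :
    minus A x * plus A b = ordered A (exchange (form A) x b) := by
  rw [exchange_form]
  induction x using SymPow.induction with
  | scalar c =>
    rw [AlgHom.commutes, AlgHom.commutes, Algebra.TensorProduct.algebraMap_apply]
    change _ = plus A (fock A (algebraMap K _ c) b) * minus A 1
    simp [Algebra.algebraMap_eq_smul_one]
  | add x y hx hy => simp only [map_add, add_mul, hx, hy]
  | X_mul s x ih =>
    rw [map_mul, mul_assoc, ih, map_mul, symComul_X, minus_X]
    generalize symComul I x = w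
    induction w with
    | zero => simp
    | add v w hv hw => simp only [map_add, mul_add, hv, hw]
    | tmul y z =>
      rw [add_mul, Algebra.TensorProduct.tmul_mul_tmul, Algebra.TensorProduct.tmul_mul_tmul,
        one_mul, one_mul, map_add, map_add]
      change gen' A s.1 s.2 * (plus A (fock A y b) * minus A z) =
        plus A (fock A (SymPow.X s * y) b) * minus A z +
          plus A (fock A y b) * minus A (SymPow.X s * z)
      rw [← mul_assoc, gen'_mul_plus, fock_X_mul, add_mul, map_mul, minus_X, mul_assoc, add_comm]

theorem QuantumToroidal.ordered_mul (u v : SymPow I ⊗[K] SymPow I) :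
    ordered A (doubleMul (form A) u v) = ordered A u * ordered A v := by
  have key : ∀ (a y : SymPow I) (w : SymPow I ⊗[K] SymPow I),
      ordered A ((a ⊗ₜ[K] (1 : SymPow I)) * w * ((1 : SymPow I) ⊗ₜ[K] y)) =
        plus A a * ordered A w * minus A y := by
    intro a y w
    induction w with
    | zero => simp
    | add v w hv hw => simp only [mul_add, add_mul, map_add, hv, hw]
    | tmul b z =>
      rw [Algebra.TensorProduct.tmul_mul_tmul, Algebra.TensorProduct.tmul_mul_tmul, mul_one, one_mul]
      change plus A (a * b) * minus A (z * y) = plus A a * (plus A b * minus A z) * minus A y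
      simp only [map_mul, mul_assoc]
  induction u with
  | zero => simp
  | add u u' hu hu' => simp only [map_add, LinearMap.add_apply, add_mul, hu, hu']
  | tmul a x =>
    induction v with
    | zero => simp
    | add v v' hv hv' => simp only [map_add, mul_add, hv, hv']
    | tmul b y =>
      refine (key a y _).trans ?_
      rw [← minus_mul_plus, ordered_tmul, ordered_tmul]
      simp only [mul_assoc]

theorem QuantumToroidal.ordered_surjective : Function.Surjective (ordered A) := by
  intro z
  obtain ⟨z, rfl⟩ := RingQuot.mkAlgHom_surjective K (PRel A) z
  induction z using FreeAlgebra.induction with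
  | grade0 c =>
    exact ⟨algebraMap K _ c ⊗ₜ 1, by simp⟩
  | grade1 g =>
    cases g with
    | plus n i => exact ⟨SymPow.X (n, i) ⊗ₜ 1, by simp [gen]⟩
    | minus n i => exact ⟨1 ⊗ₜ SymPow.X (n, i), by simp [gen']⟩
  | mul y z hy hz =>
    obtain ⟨u, hu⟩ := hy
    obtain ⟨v, hv⟩ := hz
    exact ⟨doubleMul (form A) u v, by rw [ordered_mul, hu, hv, map_mul]⟩
  | add y z hy hz =>
    obtain ⟨u, hu⟩ := hy
    obtain ⟨v, hv⟩ := hz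
    exact ⟨u + v, by rw [map_add, hu, hv, map_add]⟩

/-- The action on Fock space on generators. -/
def fockGen : Gen ℕ+ I → Module.End K (SymPow I)
  | .plus n i => LinearMap.mulLeft K (SymPow.X (n, i))
  | .minus n i => (annihilation A (n, i) : SymPow I →ₗ[K] SymPow I)

/-- The Fock space representation. -/
def QuantumToroidal.fockRep : QuantumToroidal A →ₐ[K] Module.End K (SymPow I) :=
  RingQuot.liftAlgHom K ⟨FreeAlgebra.lift K (fockGen A), by
    intro x y hxy
    cases hxy with
    | p_comm m n i j =>
      ext a
      simp [fockGen, mul_left_comm]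
    | p_comm' m n i j =>
      ext a
      simp [fockGen, annihilation_comm A (m, i) (n, j) a]
    | p_mixed m n i j =>
      ext a
      rw [map_add, map_mul, map_mul, AlgHom.commutes]
      simp only [FreeAlgebra.lift_ι_apply, fockGen, Module.End.mul_apply, LinearMap.add_apply,
        LinearMap.mulLeft_apply, Derivation.coeFn_coe, Derivation.leibniz, annihilation_X,
        Module.algebraMap_end_apply, smul_eq_mul, genPairing]
      rw [mul_comm a, ← Algebra.smul_def]
      congr 2
      split_ifs with h
      · rw [h]
      · rfl⟩

theorem QuantumToroidal.fockRep_plus (a b : SymPow I) : fockRep A (plus A a) b = a * b := by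
  induction a using SymPow.induction with
  | scalar c => simp [Algebra.smul_def]
  | add x y hx hy => simp [hx, hy, add_mul]
  | X_mul s a ih =>
    rw [map_mul, map_mul, Module.End.mul_apply, ih, plus_X]
    simp [fockRep, gen, fockGen, mul_assoc]

theorem QuantumToroidal.fockRep_minus (x b : SymPow I) :
    fockRep A (minus A x) b = fock A x b := by
  induction x using SymPow.induction with
  | scalar c => simp
  | add x y hx hy => simp [hx, hy]
  | X_mul s a ih =>
    rw [map_mul, map_mul, Module.End.mul_apply, ih, minus_X, fock_X_mul]
    simp [fockRep, gen', fockGen]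

theorem QuantumToroidal.fockRep_ordered_X_mul (hA : A.IsSymm) (t : ℕ+ × I)
    (u : SymPow I ⊗[K] SymPow I) (b : SymPow I) :
    fockRep A (ordered A u) (SymPow.X t * b) = SymPow.X t * fockRep A (ordered A u) b +
      fockRep A (ordered A ((annihilation A t : SymPow I →ₗ[K] SymPow I).lTensor (SymPow I) u)) b := by
  induction u with
  | zero => simp
  | add u v hu hv => simp only [map_add, LinearMap.add_apply, hu, hv]; ring
  | tmul a x =>
    change fockRep A (plus A a * minus A x) _ = SymPow.X t * fockRep A (plus A a * minus A x) _ +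
      fockRep A (plus A a * minus A (annihilation A t x)) _
    simp only [map_mul, Module.End.mul_apply, fockRep_plus, fockRep_minus, fock_X_mul_apply A hA]
    ring

/-- Commuting with multiplication by `p_t` shows that applying `annihilation A t` to the right slot
of `u` again gives an element acting by zero. Iterating and evaluating at `1` produces the pairing
with every `y`. -/
theorem QuantumToroidal.lTensor_form_eq_zero (hA : A.IsSymm) (u : SymPow I ⊗[K] SymPow I)
    (hu : ∀ b, fockRep A (ordered A u) b = 0) (y : SymPow I) :
    TensorProduct.rid K (SymPow I) (((form A).flip y).lTensor (SymPow I) u) = 0 := by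
  induction y using SymPow.induction generalizing u with
  | scalar c =>
    have h1 : ∀ v : SymPow I ⊗[K] SymPow I, TensorProduct.rid K (SymPow I)
        (((form A).flip (algebraMap K (SymPow I) c)).lTensor (SymPow I) v) =
          c • fockRep A (ordered A v) 1 := by
      intro v
      induction v with
      | zero => simp
      | add v w hv hw => simp only [map_add, LinearMap.add_apply, hv, hw, smul_add]
      | tmul a x =>
        change _ = c • fockRep A (plus A a * minus A x) 1
        simp [fockRep_plus, fockRep_minus, fock_one, form_one_right, Algebra.algebraMap_eq_smul_one,
          smul_smul]
    rw [h1, hu, smul_zero]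
  | add a b ha hb => rw [map_add, LinearMap.lTensor_add, LinearMap.add_apply, map_add, ha u hu,
      hb u hu, add_zero]
  | X_mul t y ih =>
    have h1 : (form A).flip (SymPow.X t * y) =
        (form A).flip y ∘ₗ (annihilation A t : SymPow I →ₗ[K] SymPow I) :=
      LinearMap.ext fun x => form_X_mul A hA t x y
    rw [h1, LinearMap.lTensor_comp_apply]
    refine ih _ fun b => ?_
    have h2 := fockRep_ordered_X_mul A hA t u b
    rwa [hu, hu, mul_zero, zero_add, eq_comm] at h2

variable {A}

/-- Expand `u` along the monomial basis of the left factor: each right coefficient pairs to zero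
with all `y`, so it vanishes by nondegeneracy. -/
theorem IsSimplyLaced.ordered_injective [Fintype I] (hA : IsSimplyLaced A) :
    Function.Injective (QuantumToroidal.ordered A) := by
  classical
  refine (injective_iff_map_eq_zero _).2 fun u hu => ?_
  have h1 := QuantumToroidal.lTensor_form_eq_zero A hA.symm u fun b => by
    rw [hu]; simp
  have h2 : ∀ (e : ℕ+ × I →₀ ℕ) (y : SymPow I) (v : SymPow I ⊗[K] SymPow I),
      form A (TensorProduct.equivFinsuppOfBasisLeft (symBasis I) v e) y =
        (symBasis I).repr (TensorProduct.rid K (SymPow I)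
          (((form A).flip y).lTensor (SymPow I) v)) e := by
    intro e y v
    induction v with
    | zero => simp
    | add v w hv hw => simp only [map_add, Finsupp.add_apply, LinearMap.add_apply, hv, hw]
    | tmul a x => simp [mul_comm]
  apply (TensorProduct.equivFinsuppOfBasisLeft (symBasis I)).injective
  rw [map_zero]
  ext e : 1
  refine hA.form_nondegenerate fun y => ?_
  rw [h2, h1, map_zero, Finsupp.zero_apply]

/-- The Heisenberg double is the quantum toroidal Heisenberg algebra. -/
def IsSimplyLaced.orderedEquiv [Fintype I] (hA : IsSimplyLaced A) :
    SymDouble A ≃ₗ[K] QuantumToroidal A :=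
  LinearEquiv.ofBijective (QuantumToroidal.ordered A)
    ⟨hA.ordered_injective, QuantumToroidal.ordered_surjective A⟩

end Heisenberg

/-! ### The complete symmetric functions as free generators -/

section Complete

variable {I : Type*}

theorem newtonCoeff_smul_p (n : ℕ+) (i : I) :
    SymPow.X (n, i) = (newtonCoeff n)⁻¹ • newtonCoeff n • p n i := by
  rw [p_coe, inv_smul_smul₀ (newtonCoeff_ne_zero n.ne_zero)]

/-- Newton's recursion can be solved for `p_n`, whose cofactor is `h_0 = 1`. -/
theorem X_mem_adjoin_h (s : ℕ+ × I) :
    SymPow.X s ∈ Algebra.adjoin K (Set.range fun t : ℕ × I => h t.1 t.2) := by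
  set C := Algebra.adjoin K (Set.range fun t : ℕ × I => h t.1 t.2) with hC
  have hmem : ∀ n i, h n i ∈ C := fun n i => Algebra.subset_adjoin ⟨(n, i), rfl⟩
  have key : ∀ (n : ℕ) (i : I), newtonCoeff n • p n i ∈ C := by
    intro n i
    induction n using Nat.strong_induction_on with
    | _ n ih =>
      have h1 := h_newton n i
      rw [← Finset.add_sum_erase _ _ (Finset.HasAntidiagonal.mem_antidiagonal.2
        (add_zero n) : (n, 0) ∈ _),
        h_zero, mul_one, ← sub_eq_iff_eq_add] at h1
      rw [← h1]
      refine C.sub_mem (C.smul_mem (hmem n i) _) (C.sum_mem fun x hx => ?_)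
      have hx' := Finset.HasAntidiagonal.mem_antidiagonal.1 (Finset.mem_of_mem_erase hx)
      rw [← smul_mul_assoc]
      refine C.mul_mem (ih x.1 ?_) (hmem _ _)
      have := Finset.ne_of_mem_erase hx
      by_contra hlt
      exact this (Prod.ext (by simp only; omega) (by simp only; omega))
  rw [← Prod.mk.eta (p := s), newtonCoeff_smul_p]
  exact C.smul_mem (key _ _) _

theorem SymPow.induction_h {P : SymPow I → Prop} (a : SymPow I)
    (scalar : ∀ c : K, P (algebraMap K (SymPow I) c))
    (add : ∀ a b, P a → P b → P (a + b))
    (h_mul : ∀ n i a, P a → P (h n i * a)) : P a := by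
  have hs : Function.Surjective
      (MvPolynomial.aeval (R := K) fun t : ℕ × I => h t.1 t.2) := by
    rw [← AlgHom.range_eq_top, ← Algebra.adjoin_range_eq_range_aeval, eq_top_iff]
    intro b _
    induction b using SymPow.induction with
    | scalar c => exact Subalgebra.algebraMap_mem _ c
    | add a b ha hb => exact Subalgebra.add_mem _ (ha trivial) (hb trivial)
    | X_mul s a ha => exact Subalgebra.mul_mem _ (X_mem_adjoin_h s) (ha trivial)
  obtain ⟨f, rfl⟩ := hs a
  induction f using MvPolynomial.induction_on with
  | C c => rw [MvPolynomial.aeval_C]; exact scalar c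
  | add f g hf hg => rw [map_add]; exact add _ _ hf hg
  | mul_X f t hf => rw [map_mul, MvPolynomial.aeval_X, mul_comm]; exact h_mul _ _ _ hf

theorem SymPow.algHom_ext_h {B : Type*} [Semiring B] [Algebra K B] {f g : SymPow I →ₐ[K] B}
    (hfg : ∀ n i, f (h n i) = g (h n i)) : f = g := by
  ext a
  induction a using SymPow.induction_h with
  | scalar c => simp
  | add a b ha hb => rw [map_add, map_add, ha, hb]
  | h_mul n i a ha => rw [map_mul, map_mul, hfg, ha]

/-- Choose the images of the power sums from the logarithmic derivative `z c' / c`; then the images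
of the `h n i` obey the same recursion as `c`. -/
theorem SymPow.exists_algHom_h {B : Type*} [CommRing B] [Algebra K B] (c : ℕ → I → B)
    (hc : ∀ i, c 0 i = 1) : ∃ F : SymPow I →ₐ[K] B, ∀ n i, F (h n i) = c n i := by
  let L : I → PowerSeries B := fun i => PowerSeries.X *
    PowerSeries.derivative B (PowerSeries.mk fun n => c n i) *
      PowerSeries.invOfUnit (PowerSeries.mk fun n => c n i) 1
  have hL : ∀ i, L i * (PowerSeries.mk fun n => c n i) =
      PowerSeries.X * PowerSeries.derivative B (PowerSeries.mk fun n => c n i) := fun i => by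
    rw [mul_assoc, mul_comm (PowerSeries.invOfUnit _ _), PowerSeries.mul_invOfUnit, mul_one]
    simp [hc]
  let F : SymPow I →ₐ[K] B :=
    SymPow.lift fun s => (newtonCoeff s.1)⁻¹ • PowerSeries.coeff (s.1 : ℕ) (L s.2)
  have hF : ∀ n i, newtonCoeff n • F (p n i) = PowerSeries.coeff n (L i) := by
    intro n i
    rcases Nat.eq_zero_or_pos n with rfl | hn
    · simp [L]
    · rw [p, dif_pos hn, SymPow.lift_X]
      exact smul_inv_smul₀ (newtonCoeff_ne_zero hn.ne') _
  refine ⟨F, fun n i => ?_⟩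
  refine newton_unique (w := fun k => PowerSeries.coeff k (L i)) (F := fun n => F (h n i))
    (G := fun n => c n i) (by simp [L]) (by simp [h_zero, hc]) ?_ ?_ n
  · intro n
    rw [← map_smul, h_newton, map_sum]
    refine Finset.sum_congr rfl fun x _ => ?_
    rw [map_smul, map_mul, ← smul_mul_assoc, hF]
  · intro n
    have h1 := congrArg (PowerSeries.coeff n) (hL i)
    rw [coeff_X_mul_derivative, PowerSeries.coeff_mul, PowerSeries.coeff_mk] at h1
    simpa using h1.symm

theorem SymPow.exists_algHom_h_of_commute {B : Type*} [Ring B] [Algebra K B] (c : ℕ → I → B)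
    (hc : ∀ i, c 0 i = 1) (hcomm : ∀ m n i j, c m i * c n j = c n j * c m i) :
    ∃ F : SymPow I →ₐ[K] B, ∀ n i, F (h n i) = c n i := by
  obtain ⟨C, _, _, ι, g, hι, hg⟩ := exists_commRing_of_commute (fun s : ℕ × I => c s.1 s.2)
    fun s t => hcomm _ _ _ _
  obtain ⟨F, hF⟩ := SymPow.exists_algHom_h (fun n i => g (n, i)) fun i => hι (by
    rw [hg, map_one, hc])
  exact ⟨ι.comp F, fun n i => by simp [hF, hg]⟩

end Complete

/-! ### The presentation by complete symmetric functions -/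

section Relations

variable {I : Type*} {A : Matrix I I ℤ}

/-- The normally ordered form of `h'_{n,i} h_{m,j}`. -/
def hExchange (A : Matrix I I ℤ) (n m : ℕ) (i j : I) : FreeAlgebra K (Gen ℕ I) :=
  ∑ k ∈ Finset.range (n + 1),
    form A (h k i) (h k j) • (hFree ((m : ℤ) - k) j * hFree' ((n : ℤ) - k) i)

theorem IsSimplyLaced.hExchange_self (hA : IsSimplyLaced A) (n m : ℕ) (i : I) :
    hExchange A n m i i = ∑ k ∈ Finset.range (n + 1),
      qint ((k : ℤ) + 1) • (hFree ((m : ℤ) - k) i * hFree' ((n : ℤ) - k) i) := by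
  simp only [hExchange, form_h_h_self hA.symm (hA.diag i)]

theorem IsSimplyLaced.hExchange_adjacent (hA : IsSimplyLaced A) {i j : I} (hij : A i j = -1)
    (n m : ℕ) : hExchange A n m i j =
      hFree m j * hFree' n i + hFree ((m : ℤ) - 1) j * hFree' ((n : ℤ) - 1) i := by
  simp only [hExchange, form_h_h_adjacent hA.symm hij]
  cases n with
  | zero => simp [hFree']
  | succ n =>
    rw [Finset.sum_range_succ', Finset.sum_range_succ', Finset.sum_eq_zero fun k _ => by simp]
    simp [add_comm]

theorem IsSimplyLaced.hExchange_distant (hA : IsSimplyLaced A) {i j : I} (hij : A i j = 0)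
    (n m : ℕ) : hExchange A n m i j = hFree m j * hFree' n i := by
  simp only [hExchange, form_h_h_distant hA.symm hij]
  rw [Finset.sum_range_succ', Finset.sum_eq_zero fun k _ => by simp]
  simp

theorem IsSimplyLaced.entry (hA : IsSimplyLaced A) (i j : I) :
    i = j ∨ A i j = 0 ∨ A i j = -1 := by
  by_cases hij : i = j
  · exact Or.inl hij
  · exact Or.inr (hA.offDiag i j hij)

/-- Merges the three mixed relations into one exchange rule. -/
theorem IsSimplyLaced.mkAlgHom_hFree'_mul_hFree (hA : IsSimplyLaced A) (n m : ℕ) (i j : I) :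
    RingQuot.mkAlgHom K (HRel A) (hFree' n i * hFree m j) =
      RingQuot.mkAlgHom K (HRel A) (hExchange A n m i j) := by
  rcases hA.entry i j with rfl | hij | hij
  · rw [hA.hExchange_self]
    exact RingQuot.mkAlgHom_rel K (HRel.same n m i)
  · rw [hA.hExchange_distant hij]
    exact RingQuot.mkAlgHom_rel K (HRel.distant n m i j hij)
  · rw [hA.hExchange_adjacent hij]
    exact RingQuot.mkAlgHom_rel K (HRel.adjacent n m i j hij)

theorem hFree_natCast (n : ℕ) (i : I) : hFree n i = FreeAlgebra.ι K (Gen.plus n i) := by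
  simp [hFree]

theorem hFree'_natCast (n : ℕ) (i : I) : hFree' n i = FreeAlgebra.ι K (Gen.minus n i) := by
  simp [hFree']

/-- The complete symmetric functions in the quantum toroidal algebra. -/
def hValue (A : Matrix I I ℤ) : Gen ℕ I → QuantumToroidal A
  | .plus n i => QuantumToroidal.plus A (h n i)
  | .minus n i => QuantumToroidal.minus A (h n i)

theorem lift_hValue_hFree (n : ℕ) (i : I) :
    FreeAlgebra.lift K (hValue A) (hFree n i) = QuantumToroidal.plus A (h n i) := by
  simp [hFree_natCast, hValue]

theorem lift_hValue_hFree' (n : ℕ) (i : I) :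
    FreeAlgebra.lift K (hValue A) (hFree' n i) = QuantumToroidal.minus A (h n i) := by
  simp [hFree'_natCast, hValue]

theorem lift_hValue_hExchange (n m : ℕ) (i j : I) :
    FreeAlgebra.lift K (hValue A) (hFree' n i * hFree m j) =
      FreeAlgebra.lift K (hValue A) (hExchange A n m i j) := by
  rw [map_mul, lift_hValue_hFree, lift_hValue_hFree', QuantumToroidal.minus_mul_plus,
    exchange_form, symComul_h, hExchange, map_sum, map_sum, map_sum,
    Finset.Nat.sum_antidiagonal_eq_sum_range_succ_mk]
  refine Finset.sum_congr rfl fun k hk => ?_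
  have hk := Finset.mem_range_succ_iff.1 hk
  rw [TensorProduct.map_tmul, QuantumToroidal.ordered_tmul, LinearMap.flip_apply,
    AlgHom.toLinearMap_apply, fock_h (h_mem_symDegree k i), LinearMap.id_apply, map_smul, map_mul,
    ← Nat.cast_sub hk, lift_hValue_hFree']
  split_ifs with hm
  · rw [← Nat.cast_sub hm, lift_hValue_hFree, map_smul, smul_mul_assoc]
  -- For `k > m` the zero branch of `fock_h` corresponds to `hFree` at a negative index.
  · rw [hFree, if_pos (by omega)]
    simp

/-- The algebra homomorphism between the algebras given by the two presentations. -/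
def IsSimplyLaced.toToroidal (hA : IsSimplyLaced A) : HAlgebra A →ₐ[K] QuantumToroidal A :=
  RingQuot.liftAlgHom K ⟨FreeAlgebra.lift K (hValue A), by
    intro x y hxy
    cases hxy with
    | h_zero i =>
      rw [← Nat.cast_zero, lift_hValue_hFree, h_zero, map_one, map_one]
    | h_zero' i =>
      rw [← Nat.cast_zero, lift_hValue_hFree', h_zero, map_one, map_one]
    | h_comm n m i j =>
      rw [map_mul, map_mul, lift_hValue_hFree, lift_hValue_hFree, ← map_mul, mul_comm, map_mul]
    | h_comm' n m i j =>
      rw [map_mul, map_mul, lift_hValue_hFree', lift_hValue_hFree', ← map_mul, mul_comm, map_mul]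
    | same n m i => rw [lift_hValue_hExchange, hA.hExchange_self]
    | adjacent n m i j hij => rw [lift_hValue_hExchange, hA.hExchange_adjacent hij]
    | distant n m i j hij => rw [lift_hValue_hExchange, hA.hExchange_distant hij]⟩

theorem IsSimplyLaced.toToroidal_gen (hA : IsSimplyLaced A) (n : ℕ) (i : I) :
    hA.toToroidal (HAlgebra.gen A n i) = QuantumToroidal.plus A (h n i) := by
  simp [toToroidal, HAlgebra.gen, hValue]

theorem IsSimplyLaced.toToroidal_gen' (hA : IsSimplyLaced A) (n : ℕ) (i : I) :
    hA.toToroidal (HAlgebra.gen' A n i) = QuantumToroidal.minus A (h n i) := by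
  simp [toToroidal, HAlgebra.gen', hValue]

theorem HAlgebra.exists_plus (A : Matrix I I ℤ) :
    ∃ F : SymPow I →ₐ[K] HAlgebra A, ∀ n i, F (h n i) = HAlgebra.gen A n i := by
  refine SymPow.exists_algHom_h_of_commute _ (fun i => ?_) fun m n i j => ?_
  · simpa [hFree, gen] using RingQuot.mkAlgHom_rel K (HRel.h_zero (A := A) i)
  · simpa [hFree_natCast, gen] using RingQuot.mkAlgHom_rel K (HRel.h_comm (A := A) m n i j)

theorem HAlgebra.exists_minus (A : Matrix I I ℤ) :
    ∃ F : SymPow I →ₐ[K] HAlgebra A, ∀ n i, F (h n i) = HAlgebra.gen' A n i := by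
  refine SymPow.exists_algHom_h_of_commute _ (fun i => ?_) fun m n i j => ?_
  · simpa [hFree', gen'] using RingQuot.mkAlgHom_rel K (HRel.h_zero' (A := A) i)
  · simpa [hFree'_natCast, gen'] using RingQuot.mkAlgHom_rel K (HRel.h_comm' (A := A) m n i j)

/-- Normally ordered products span the algebra presented by the complete symmetric functions. -/
theorem IsSimplyLaced.ordered_surjective (hA : IsSimplyLaced A) {F G : SymPow I →ₐ[K] HAlgebra A}
    (hF : ∀ n i, F (h n i) = HAlgebra.gen A n i) (hG : ∀ n i, G (h n i) = HAlgebra.gen' A n i) :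
    Function.Surjective
      (LinearMap.mul' K (HAlgebra A) ∘ₗ TensorProduct.map F.toLinearMap G.toLinearMap) := by
  set κ := LinearMap.mul' K (HAlgebra A) ∘ₗ TensorProduct.map F.toLinearMap G.toLinearMap with hκ
  have hκt : ∀ a x, κ (a ⊗ₜ x) = F a * G x := fun a x => rfl
  have hleft : ∀ (a : SymPow I) (w), w ∈ LinearMap.range κ → F a * w ∈ LinearMap.range κ := by
    rintro a _ ⟨u, rfl⟩
    induction u with
    | zero => simp
    | add u v hu hv => rw [map_add, mul_add]; exact Submodule.add_mem _ hu hv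
    | tmul b x => exact ⟨(a * b) ⊗ₜ x, by rw [hκt, hκt, map_mul, mul_assoc]⟩
  have hright : ∀ (a : SymPow I) (w), w ∈ LinearMap.range κ → w * G a ∈ LinearMap.range κ := by
    rintro a _ ⟨u, rfl⟩
    induction u with
    | zero => simp
    | add u v hu hv => rw [map_add, add_mul]; exact Submodule.add_mem _ hu hv
    | tmul b x => exact ⟨b ⊗ₜ (x * a), by rw [hκt, hκt, map_mul, mul_assoc]⟩
  have hrel : ∀ n m i j, G (h n i) * F (h m j) = ∑ k ∈ Finset.range (n + 1),
      form A (h k i) (h k j) • ((if k ≤ m then F (h (m - k) j) else 0) * G (h (n - k) i)) := by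
    intro n m i j
    have h1 := hA.mkAlgHom_hFree'_mul_hFree n m i j
    rw [map_mul, hFree_natCast, hFree'_natCast, hExchange, map_sum] at h1
    rw [hF, hG]
    refine h1.trans (Finset.sum_congr rfl fun k hk => ?_)
    have hk := Finset.mem_range_succ_iff.1 hk
    rw [map_smul, map_mul, ← Nat.cast_sub hk, hFree'_natCast, hG]
    split_ifs with hm
    · rw [← Nat.cast_sub hm, hFree_natCast, hF]; rfl
    · rw [hFree, if_pos (by omega), map_zero, zero_mul, zero_mul]
  -- The induction on `b` keeps `n` free because the exchange rule lowers it to `n - k`.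
  have hmove : ∀ (b : SymPow I) n i, G (h n i) * F b ∈ LinearMap.range κ := by
    intro b
    induction b using SymPow.induction_h with
    | scalar c =>
      intro n i
      exact ⟨algebraMap K _ c ⊗ₜ h n i, by rw [hκt, AlgHom.commutes, Algebra.commutes]⟩
    | add a b ha hb =>
      intro n i
      rw [map_add, mul_add]
      exact Submodule.add_mem _ (ha n i) (hb n i)
    | h_mul m j b ih =>
      intro n i
      rw [map_mul, ← mul_assoc, hrel, Finset.sum_mul]
      refine Submodule.sum_mem _ fun k _ => ?_
      rw [smul_mul_assoc, mul_assoc]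
      refine Submodule.smul_mem _ _ ?_
      split_ifs
      · exact hleft _ _ (ih _ _)
      · simp
  have hmoves : ∀ (z : FreeAlgebra K (Gen ℕ I)) (w), w ∈ LinearMap.range κ →
      RingQuot.mkAlgHom K (HRel A) z * w ∈ LinearMap.range κ := by
    intro z
    induction z using FreeAlgebra.induction with
    | grade0 c =>
      intro w hw
      rw [AlgHom.commutes, ← Algebra.smul_def]
      exact Submodule.smul_mem _ _ hw
    | grade1 g =>
      intro w hw
      cases g with
      | plus n i =>
        have := hleft (h n i) w hw
        rwa [hF] at this
      | minus n i =>
        change HAlgebra.gen' A n i * w ∈ _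
        rw [← hG]
        obtain ⟨u, rfl⟩ := hw
        induction u with
        | zero => simp
        | add u v hu hv => rw [map_add, mul_add]; exact Submodule.add_mem _ hu hv
        | tmul b x =>
          rw [hκt, ← mul_assoc]
          exact hright _ _ (hmove _ _ _)
    | mul y z hy hz =>
      intro w hw
      rw [map_mul, mul_assoc]
      exact hy _ (hz _ hw)
    | add y z hy hz =>
      intro w hw
      rw [map_add, add_mul]
      exact Submodule.add_mem _ (hy _ hw) (hz _ hw)
  intro z
  obtain ⟨z, rfl⟩ := RingQuot.mkAlgHom_surjective K (HRel A) z
  have := hmoves z 1 ⟨1 ⊗ₜ 1, by rw [hκt, map_one, map_one, one_mul]⟩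
  rwa [mul_one] at this

/-- The composite of `toToroidal` with the surjection `κ` is the bijection `ordered`. -/
theorem IsSimplyLaced.toToroidal_bijective [Fintype I] (hA : IsSimplyLaced A) :
    Function.Bijective hA.toToroidal := by
  obtain ⟨F, hF⟩ := HAlgebra.exists_plus A
  obtain ⟨G, hG⟩ := HAlgebra.exists_minus A
  have hs := hA.ordered_surjective hF hG
  set κ := LinearMap.mul' K (HAlgebra A) ∘ₗ TensorProduct.map F.toLinearMap G.toLinearMap
  have h1 : hA.toToroidal.comp F = QuantumToroidal.plus A :=
    SymPow.algHom_ext_h fun n i => by rw [AlgHom.comp_apply, hF, hA.toToroidal_gen]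
  have h2 : hA.toToroidal.comp G = QuantumToroidal.minus A :=
    SymPow.algHom_ext_h fun n i => by rw [AlgHom.comp_apply, hG, hA.toToroidal_gen']
  have h3 : ∀ u, hA.toToroidal (κ u) = QuantumToroidal.ordered A u := by
    intro u
    induction u with
    | zero => simp
    | add u v hu hv => simp only [map_add, hu, hv]
    | tmul a x =>
      rw [QuantumToroidal.ordered_tmul, ← h1, ← h2]
      exact map_mul hA.toToroidal (F a) (G x)
  constructor
  · refine (injective_iff_map_eq_zero _).2 fun z hz => ?_
    obtain ⟨u, rfl⟩ := hs z
    rw [h3] at hz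
    rw [hA.ordered_injective (hz.trans (map_zero _).symm), map_zero]
  · intro z
    obtain ⟨u, rfl⟩ := QuantumToroidal.ordered_surjective A z
    exact ⟨κ u, h3 u⟩

/-- Induction through `[k+2] = q⁻¹ [k+1] + q^(k+1)`. -/
theorem qint_succ_mem_adjoin (k : ℕ) :
    qint ((k : ℤ) + 1) ∈ Algebra.adjoin ℤ ({q, q⁻¹} : Set K) := by
  have hq : q ∈ Algebra.adjoin ℤ ({q, q⁻¹} : Set K) := Algebra.subset_adjoin (by simp)
  have hq' : q⁻¹ ∈ Algebra.adjoin ℤ ({q, q⁻¹} : Set K) := Algebra.subset_adjoin (by simp)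
  induction k with
  | zero => simp [qint_one]
  | succ k ih =>
    have h1 : qint (((k + 1 : ℕ) : ℤ) + 1) = q⁻¹ * qint ((k : ℤ) + 1) + q ^ (k + 1) := by
      have e1 : (((k + 1 : ℕ) : ℤ) + 1) = ((k + 2 : ℕ) : ℤ) := by push_cast; ring
      have e2 : ((k : ℤ) + 1) = ((k + 1 : ℕ) : ℤ) := by push_cast; ring
      have hd := q_inv_sub_q_ne_zero
      rw [e1, e2, qint_natCast, qint_natCast]
      rw [div_eq_iff hd, add_mul, mul_assoc, div_mul_cancel₀ _ hd]
      ring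
    rw [h1]
    exact Subalgebra.add_mem _ (Subalgebra.mul_mem _ hq' ih) (Subalgebra.pow_mem _ hq _)

end Relations

end QHeis

end

/-! ### Assembly of the isomorphisms -/

theorem mainTheorem8 {I : Type*} [Fintype I] (A : Matrix I I ℤ)
    (hA : QHeis.IsFiniteADE A ∨ (QHeis.IsAffineADE A ∧ ¬ QHeis.IsTypeA11 A)) :
    -- the Heisenberg double is the one of a dual pair of Hopf algebras
    QHeis.IsDualPair (QHeis.symDegree I) (QHeis.symDegree I) (QHeis.form A) ∧
    -- the Heisenberg double is the algebra presented by the `h_{n,i}` and `h'_{n,i}`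
    (∃ φ : QHeis.HAlgebra A ≃ₗ[QHeis.K] QHeis.SymDouble A,
      φ 1 = 1 ∧ (∀ x y, φ (x * y) = φ x * φ y) ∧
      (∀ n i, φ (QHeis.HAlgebra.gen A n i) = QHeis.smash (QHeis.form A) (QHeis.h n i) 1) ∧
      (∀ n i, φ (QHeis.HAlgebra.gen' A n i) = QHeis.smash (QHeis.form A) 1 (QHeis.h n i))) ∧
    -- the coefficients of the relations lie in `ℤ[q, q⁻¹]`
    (∀ k : ℕ, QHeis.qint ((k : ℤ) + 1) ∈ Algebra.adjoin ℤ ({QHeis.q, QHeis.q⁻¹} : Set QHeis.K)) ∧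
    -- the Heisenberg double is the quantum toroidal Heisenberg algebra
    (∃ ψ : QHeis.QuantumToroidal A ≃ₗ[QHeis.K] QHeis.SymDouble A,
      ψ 1 = 1 ∧ (∀ x y, ψ (x * y) = ψ x * ψ y) ∧
      (∀ (n : ℕ+) i, ψ (QHeis.QuantumToroidal.gen A n i) =
        QHeis.smash (QHeis.form A) (QHeis.p n i) 1) ∧
      (∀ (n : ℕ+) i, ψ (QHeis.QuantumToroidal.gen' A n i) =
        QHeis.smash (QHeis.form A) 1 (QHeis.p n i))) := by
  have hS : QHeis.IsSimplyLaced A := hA.elim (·.isSimplyLaced) fun h => h.1.isSimplyLaced h.2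
  have hone : hS.orderedEquiv 1 = 1 := by
    change QHeis.QuantumToroidal.ordered A (1 ⊗ₜ 1) = 1
    rw [QHeis.QuantumToroidal.ordered_tmul, map_one, map_one, one_mul]
  have hmul : ∀ u v, hS.orderedEquiv (u * v) = hS.orderedEquiv u * hS.orderedEquiv v :=
    QHeis.QuantumToroidal.ordered_mul A
  have hplus : ∀ a, hS.orderedEquiv (QHeis.smash (QHeis.form A) a 1) =
      QHeis.QuantumToroidal.plus A a := fun a => by
    change QHeis.QuantumToroidal.ordered A (a ⊗ₜ 1) = _
    rw [QHeis.QuantumToroidal.ordered_tmul, map_one, mul_one]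
  have hminus : ∀ x, hS.orderedEquiv (QHeis.smash (QHeis.form A) 1 x) =
      QHeis.QuantumToroidal.minus A x := fun x => by
    change QHeis.QuantumToroidal.ordered A (1 ⊗ₜ x) = _
    rw [QHeis.QuantumToroidal.ordered_tmul, map_one, one_mul]
  have hmul' : ∀ x y, hS.orderedEquiv.symm (x * y) =
      hS.orderedEquiv.symm x * hS.orderedEquiv.symm y := fun x y => by
    rw [LinearEquiv.symm_apply_eq, hmul, LinearEquiv.apply_symm_apply,
      LinearEquiv.apply_symm_apply]
  refine ⟨hS.isDualPair, ⟨(LinearEquiv.ofBijective hS.toToroidal.toLinearMap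
    hS.toToroidal_bijective).trans hS.orderedEquiv.symm, ?_, fun x y => ?_, fun n i => ?_,
    fun n i => ?_⟩, QHeis.qint_succ_mem_adjoin, hS.orderedEquiv.symm, ?_, hmul', fun n i => ?_,
    fun n i => ?_⟩
  · change hS.orderedEquiv.symm (hS.toToroidal 1) = 1
    rw [LinearEquiv.symm_apply_eq, hone, map_one]
  · change hS.orderedEquiv.symm (hS.toToroidal (x * y)) = _
    rw [map_mul, hmul']
    rfl
  · change hS.orderedEquiv.symm (hS.toToroidal _) = _
    rw [LinearEquiv.symm_apply_eq, hplus, hS.toToroidal_gen]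
  · change hS.orderedEquiv.symm (hS.toToroidal _) = _
    rw [LinearEquiv.symm_apply_eq, hminus, hS.toToroidal_gen']
  · rw [LinearEquiv.symm_apply_eq, hone]
  · rw [LinearEquiv.symm_apply_eq, hplus, QHeis.p_coe, QHeis.QuantumToroidal.plus_X]
  · rw [LinearEquiv.symm_apply_eq, hminus, QHeis.p_coe, QHeis.QuantumToroidal.minus_X]
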